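/- **Setting.** Let $\hbar>0$, $\phi,\beta,\gamma,\delta\in\mathbb C$, $\varepsilon\in\mathbb R$. On a Hilbert space $\mathcal H$ let $x$ and $v_k,w_k$ ($k\ge1$) be operators satisfying (in Weyl form) the canonical commutation relations $$[x,x^*]=\hbar,\quad [v_k,v_k^*]=(1-|\phi|^2)\hbar,\quad [w_k,w_k^*]=(\varepsilon-|\gamma|^2)\hbar,\quad [w_k,v_k^*]=-\bar\phi\gamma\hbar ,$$ all other commutators of these operators and their adjoints (apart from those obtained by taking adjoints) being zero. With complex controls $u_0,u_1,\dots$ put $x_0=x$ and $$x_k=\phi x_{k-1}+\beta u_{k-1}+v_k,\qquad y_k=\gamma x_{k-1}+\delta u_{k-1}+w_k \qquad(k\ge 1).$$ The control $u_0$ is fixed and $u_k$ is chosen (possibly at random, by an arbitrary Markov kernel) on the basis of the data $u_0,\eta_1,u_1,\dots,\eta_{k-1},u_{k-1},\eta_k$, where $\eta_j$ is the result of the measurement of the $j$-th output $y_j$; write $\zeta^{k+1}=(u_0,\eta_1,u_1,\dots,\eta_k,u_k)$. Let $\mathcal A_k$, $\mathcal B_k$, $\mathcal B^\circ_k$ be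 the von Neumann algebras generated by $x_k$, by $y_k$, and by $(v_k,w_k)$. On $\mathbb C$ write $d\xi=d\,\mathrm{Re}\,\xi\;d\,\mathrm{Im}\,\xi/(\pi\hbar)$, and let $\#f(\cdot)\#$ denote the operator with symbol $f$ in the order in which first the amplitudes act and then their adjoints, so that $\#e^{i(\bar\tau Z+\tau Z^*)}\#=e^{i\tau Z^*}e^{i\bar\tau Z}$ for an amplitude $Z$. A normal state $\omega$ is described on the algebra generated by amplitudes $Z_1,\dots ,Z_n$ by the distribution $p$ if $\langle\omega,\#f(Z_1,\dots ,Z_n)\#\rangle=\int p\,f\,d\xi_1\cdots d\xi_n$ for all exponential symbols $f$; if $n=1$ and $[Z_1,Z_1^*]=\hbar$, $p$ is the Glauber distribution of $\omega$. Let $\pi$ be a normal state on $\mathcal A_0$ and $\rho^\circ_k$ normal states on $\mathcal B_k^\circ$; let $M_k:\mathcal A_{k-1}\vee\mathcal B^\circ_k\to\mathcal A_{k-1}$ be the normal positive unital transition map with $M_k(ab^\circ)=\langle\rho_k^\circ,b^\circ\rangle a$ (realized as the restriction of a normal positive unital map on all bounded operators of $\mathcal H$), and let $b_k(d\eta)=\#m_k(\eta-y_k)\#\,d\eta$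 be the indirect measurement of $y_k$. The total state $\pi_k(d\zeta^{k+1})$, a measure on the data with values in the normal functionals on $\mathcal A_k$, is defined by $\pi_0=\pi$ and $$\langle\pi_k(d\zeta^{k}\times d\eta),a\rangle=\langle\pi_{k-1}(d\zeta^{k}),M_k[b_k(d\eta)\,a]\rangle ,\qquad a\in\mathcal A_k,$$ followed by the choice of $u_k$; the a posteriori states are the weak Radon–Nikodym derivatives $\pi_k(\zeta^{k+1})=\pi_k(d\zeta^{k+1})/\langle\pi_k(d\zeta^{k+1}),\mathbf 1\rangle$. **Theorem.** Let $z,\upsilon\in\mathbb C$, $\Sigma,\sigma,\nu,\mu>0$ with $\sigma\nu>|\upsilon|^2$ and $\mu\ge\varepsilon$. Suppose that $\pi$ has the Glauber distribution $p(\xi)=\frac1\Sigma\exp\{-|\xi-z|^2/\hbar\Sigma\}$, that for every $k$ the state $\rho_k^\circ$ is described by the distribution $$q_k(\xi,\eta)=\frac{1}{\sigma\nu-|\upsilon|^2}\exp\left\{-\frac{\nu|\xi|^2+2\,\mathrm{Re}\,(\upsilon\bar\xi\eta)+\sigma|\eta|^2}{\hbar(\sigma\nu-|\upsilon|^2)}\right\}$$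 of $(v_k,w_k)$, and that $m_k(\eta)=\frac1\mu\exp\{-|\eta|^2/\hbar\mu\}$. Then, at every instant $k$, $\langle\pi_k(d\zeta^{k+1}),\mathbf 1\rangle$ is a probability measure, a posteriori states exist, and for almost all data they are given by the Gaussian Glauber distribution (with respect to $x_k$) $$p_k(\xi\mid\zeta^{k+1})=\frac1{\Sigma_k}\exp\{-|\xi-z_k|^2/\hbar\Sigma_k\},$$ where $\Sigma_k>0$ and $z_k,\Sigma_k$ are defined by the complex Kalman filter $$z_k=\phi z_{k-1}+\beta u_{k-1}+\kappa_k(\eta_k-\gamma z_{k-1}-\delta u_{k-1}),\quad z_0=z,$$ $$\Sigma_k=|\phi|^2\Sigma_{k-1}+\sigma-|\kappa_k|^2\Psi_k,\quad \Sigma_0=\Sigma,$$ $$\kappa_k=(\phi\bar\gamma\Sigma_{k-1}-\upsilon)/\Psi_k,\qquad \Psi_k=|\gamma|^2\Sigma_{k-1}+\nu+\mu>0 .$$ -/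

import Mathlib

open MeasureTheory ProbabilityTheory Complex ComplexConjugate

/-! ### The discrete linear Markovian quantum open oscillator -/

/-- Coefficients of the oscillator equations `x_k = φ x_{k-1} + β u_{k-1} + v_k`,
`y_k = γ x_{k-1} + δ u_{k-1} + w_k`, the commutator parameter `ε` of the output
(`[y_k, y_k*] = ε ħ`), and the Planck constant. -/
structure OscillatorParams where
  hbar : ℝ
  φ : ℂ
  β : ℂ
  γ : ℂ
  δ : ℂ
  ε : ℝ

/-- The basic amplitude operators: the initial amplitude `x` and the noise amplitudes.
`v j`, `w j` are the noises acting in the step from time `j` to time `j + 1`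
(that is, the operators `v_{j+1}`, `w_{j+1}`). -/
inductive Mode
  | x
  | v (j : ℕ)
  | w (j : ℕ)
  deriving DecidableEq

/-- The commutators `[i, j*]` of the basic amplitudes, in units of `ħ`:
`[x, x*] = 1`, `[v, v*] = 1 - |φ|²`, `[w, w*] = ε - |γ|²`, `[w, v*] = - conj φ * γ`
(hence `[v, w*] = - φ * conj γ`); all others vanish. -/
noncomputable def modeCommutator (P : OscillatorParams) : Mode → Mode → ℂ
  | .x, .x => 1
  | .v i, .v j => if i = j then 1 - (‖P.φ‖ : ℂ) ^ 2 else 0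
  | .w i, .w j => if i = j then (P.ε : ℂ) - (‖P.γ‖ : ℂ) ^ 2 else 0
  | .w i, .v j => if i = j then -(conj P.φ * P.γ) else 0
  | .v i, .w j => if i = j then -(P.φ * conj P.γ) else 0
  | _, _ => 0

/-- For finite linear combinations `Z = ∑ a_i z_i`, `Z' = ∑ b_j z_j` of the basic amplitudes:
the scalar `[Z, Z'*] = ħ ∑ a_i (conj b_j) [z_i, z_j*]`. -/
noncomputable def ampCommutator (P : OscillatorParams) (Z Z' : Mode →₀ ℂ) : ℂ :=
  P.hbar * Z.sum fun i a => Z'.sum fun j b => a * conj b * modeCommutator P i j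

/-- The canonical commutation relations of all the basic amplitudes, in Weyl (exponentiated) form,
on a Hilbert space `H`. `W Z` is the unitary operator `exp (i (Z + Z*))`; since
`[Z + Z*, Z' + Z'*] = [Z, Z'*] - conj [Z, Z'*] = 2 i Im [Z, Z'*]`, the canonical commutation relations
read `exp (i (Z + Z*)) exp (i (Z' + Z'*)) = exp (- i Im [Z, Z'*]) exp (i (Z + Z' + (Z + Z')*))`.
Regularity (strong continuity) means that the amplitudes exist as (unbounded) closed operators. -/
structure WeylSystem (P : OscillatorParams) (H : Type*) [NormedAddCommGroup H]
    [InnerProductSpace ℂ H] [CompleteSpace H] where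
  W : (Mode →₀ ℂ) → H →L[ℂ] H
  map_zero : W 0 = 1
  adjoint_eq : ∀ Z, ContinuousLinearMap.adjoint (W Z) = W (-Z)
  weyl : ∀ Z Z', W Z * W Z' = cexp (-(I * ((ampCommutator P Z Z').im : ℂ))) • W (Z + Z')
  regular : ∀ Z ψ, Continuous fun c : ℂ => W (c • Z) ψ

/-- Amplitudes with a c-number part: `(d, Z)` stands for the operator `d 1 + Z`. -/
abbrev Amplitude := ℂ × (Mode →₀ ℂ)

/-- A basic amplitude as an amplitude. -/
noncomputable def Mode.amp (m : Mode) : Amplitude := (0, Finsupp.single m 1)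

/-- The c-number `d` as an amplitude. -/
def constAmp (d : ℂ) : Amplitude := (d, 0)

section Quantization

variable {P : OscillatorParams} {H : Type*} [NormedAddCommGroup H]
  [InnerProductSpace ℂ H] [CompleteSpace H]

/-- `exp (i (Z + Z*))` for an amplitude `Z` with a c-number part. -/
noncomputable def WeylSystem.weylOp (S : WeylSystem P H) (Z : Amplitude) : H →L[ℂ] H :=
  cexp (I * ((2 * Z.1.re : ℝ) : ℂ)) • S.W Z.2

/-- The ordered exponential `#exp (i (Z + Z*))# = exp (i Z*) exp (i Z)` (first the amplitudes act,
then their adjoints), which equals `exp ([Z, Z*] / 2) exp (i (Z + Z*))`. -/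
noncomputable def WeylSystem.ordExp (S : WeylSystem P H) (Z : Amplitude) : H →L[ℂ] H :=
  cexp (ampCommutator P Z.2 Z.2 / 2) • S.weylOp Z

theorem ampCommutator_neg_im (Z : Mode →₀ ℂ) : (ampCommutator P Z (-Z)).im = 0 := by
  have hherm : ∀ i j, conj (modeCommutator P i j) = modeCommutator P j i := by
    intro i j
    cases i <;> cases j <;> simp only [modeCommutator, eq_comm] <;> (try split_ifs) <;>
      simp [mul_comm]
  apply Complex.conj_eq_iff_im.mp
  simp only [ampCommutator, Finsupp.sum, Finsupp.support_neg, Finsupp.coe_neg, Pi.neg_apply,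
    map_mul, map_sum, Complex.conj_ofReal, map_neg, Complex.conj_conj, hherm]
  rw [Finset.sum_comm]
  congr 1
  refine Finset.sum_congr rfl fun i _ => Finset.sum_congr rfl fun j _ => ?_
  ring

theorem WeylSystem.norm_W (S : WeylSystem P H) (Z : Mode →₀ ℂ) (ψ : H) :
    ‖S.W Z ψ‖ = ‖ψ‖ := by
  have h1 : S.W (-Z) * S.W Z = 1 := by
    have h := S.weyl (-Z) Z
    have h2 : (ampCommutator P (-Z) Z).im = 0 := by
      simpa using ampCommutator_neg_im (P := P) (-Z)
    rw [h, h2]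
    simp [S.map_zero]
  have h3 : inner ℂ (S.W Z ψ) (S.W Z ψ) = inner ℂ ψ ψ := by
    rw [← ContinuousLinearMap.adjoint_inner_right, S.adjoint_eq,
      ← mul_apply_eq_comp, h1, one_apply_eq_self]
  rw [inner_self_eq_norm_sq_to_K, inner_self_eq_norm_sq_to_K] at h3
  have h4 : ‖S.W Z ψ‖ ^ 2 = ‖ψ‖ ^ 2 := by exact_mod_cast h3
  exact (sq_eq_sq₀ (norm_nonneg _) (norm_nonneg _)).mp h4

theorem WeylSystem.norm_weylOp (S : WeylSystem P H) (Z : Amplitude) (ψ : H) :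
    ‖S.weylOp Z ψ‖ = ‖ψ‖ := by
  rw [weylOp, smul_apply, norm_smul, S.norm_W, mul_comm I,
    Complex.norm_exp_ofReal_mul_I, one_mul]

theorem WeylSystem.continuous_weylOp (S : WeylSystem P H) (Z : Amplitude) (ψ : H) :
    Continuous fun τ : ℂ => S.weylOp (conj τ • Z) ψ := by
  have h : Continuous fun τ : ℂ => S.W ((conj τ) • Z.2) ψ :=
    (S.regular Z.2 ψ).comp Complex.continuous_conj
  simp only [weylOp, smul_apply, Prod.smul_fst, Prod.smul_snd, smul_eq_mul]
  refine Continuous.smul ?_ h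
  fun_prop

theorem WeylSystem.integrable_weylOp (S : WeylSystem P H) {g : ℂ → ℂ} (hg : Integrable g)
    (Z : Amplitude) (ψ : H) : Integrable fun τ : ℂ => g τ • S.weylOp (conj τ • Z) ψ := by
  refine (hg.norm.mul_const ‖ψ‖).mono'
    (hg.aestronglyMeasurable.smul (S.continuous_weylOp Z ψ).aestronglyMeasurable) ?_
  filter_upwards with τ
  rw [norm_smul, S.norm_weylOp]

open Classical in
/-- The operator `∫ g τ exp (i (conj τ Z + τ Z*)) dτ` for an integrable weight `g`
(a strong integral). -/
noncomputable def WeylSystem.weylIntegral (S : WeylSystem P H) (g : ℂ → ℂ) (Z : Amplitude) :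
    H →L[ℂ] H :=
  if hg : Integrable g then
    LinearMap.mkContinuous
      { toFun := fun ψ => ∫ τ : ℂ, g τ • S.weylOp (conj τ • Z) ψ
        map_add' := fun ψ χ => by
          simp only [map_add, smul_add]
          exact integral_add (S.integrable_weylOp hg Z ψ) (S.integrable_weylOp hg Z χ)
        map_smul' := fun c ψ => by
          simp only [map_smul, RingHom.id_apply]
          rw [← integral_smul]
          simp only [smul_comm c] }
      (∫ τ : ℂ, ‖g τ‖)
      (fun ψ => by
        refine (norm_integral_le_integral_norm _).trans (le_of_eq ?_)
        simp only [norm_smul, S.norm_weylOp]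
        exact integral_mul_const ‖ψ‖ _)
  else 0

/-- Fourier coefficients on the plane, so that
`f ξ = ∫ (planeFourier f τ) exp (i (conj τ ξ + τ conj ξ)) dτ`. -/
noncomputable def planeFourier (f : ℂ → ℂ) (τ : ℂ) : ℂ :=
  ((Real.pi : ℂ) ^ 2)⁻¹ * ∫ ξ : ℂ, f ξ * cexp (-(I * ((2 * (conj τ * ξ).re : ℝ) : ℂ)))

/-- The operator `#f (Z)#` with symbol `f`: the superposition
`∫ (planeFourier f τ) #exp (i (conj τ Z + τ Z*))# dτ` of ordered exponentials, where
`#exp (i (conj τ Z + τ Z*))# = exp (|τ|² [Z, Z*] / 2) exp (i (conj τ Z + τ Z*))`. -/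
noncomputable def WeylSystem.symbolOp (S : WeylSystem P H) (f : ℂ → ℂ) (Z : Amplitude) :
    H →L[ℂ] H :=
  S.weylIntegral
    (fun τ => planeFourier f τ * cexp (ampCommutator P (conj τ • Z.2) (conj τ • Z.2) / 2)) Z

/-- The von Neumann algebra generated by a set of amplitudes: the double commutant of the
unitary operators `exp (i (conj τ Z + τ Z*))`. -/
def WeylSystem.algebra (S : WeylSystem P H) (A : Set Amplitude) : Set (H →L[ℂ] H) :=
  Set.centralizer (Set.centralizer {T | ∃ Z ∈ A, ∃ τ : ℂ, T = S.weylOp (conj τ • Z)})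

end Quantization

/-! ### Normal functionals, states, and distributions -/

section States

variable {H : Type*} [NormedAddCommGroup H] [InnerProductSpace ℂ H] [CompleteSpace H]

/-- Normal (ultraweakly continuous) functionals: those given by trace class operators. -/
def IsNormalFunctional (f : (H →L[ℂ] H) →ₗ[ℂ] ℂ) : Prop :=
  ∃ ψ χ : ℕ → H, Summable (fun n => ‖ψ n‖ ^ 2) ∧ Summable (fun n => ‖χ n‖ ^ 2) ∧
    ∀ a : H →L[ℂ] H, HasSum (fun n => inner ℂ (ψ n) (a (χ n))) (f a)

/-- Normal states. -/
structure IsNormalState (f : (H →L[ℂ] H) →ₗ[ℂ] ℂ) : Prop where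
  normal : IsNormalFunctional f
  nonneg : ∀ a : H →L[ℂ] H, a.IsPositive → 0 ≤ (f a).re ∧ (f a).im = 0
  map_one : f 1 = 1

/-- The measure `dξ = d Re ξ d Im ξ / (π ħ)` on the complex plane. -/
noncomputable def planeMeasure (hbar : ℝ) : Measure ℂ :=
  ENNReal.ofReal (1 / (Real.pi * hbar)) • volume

variable {P : OscillatorParams}

/-- On the algebra generated by the amplitude `Z`, the functional `f` is given by the distribution
`p`: `⟨f, #α (Z)#⟩ = ∫ p ξ α ξ dξ` for all the exponential symbols
`α ξ = exp (i (conj τ ξ + τ conj ξ))`. For `[Z, Z*] = ħ` this says that `p` is the Glauber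
distribution of `f`. -/
def WeylSystem.HasDistribution (S : WeylSystem P H) (f : (H →L[ℂ] H) →ₗ[ℂ] ℂ) (Z : Amplitude)
    (p : ℂ → ℝ) : Prop :=
  ∀ τ : ℂ, f (S.ordExp (conj τ • Z)) =
    ∫ ξ : ℂ, (p ξ : ℂ) * cexp (I * ((2 * (conj τ * ξ).re : ℝ) : ℂ)) ∂planeMeasure P.hbar

/-- The same for the algebra generated by two amplitudes `Z`, `Z'` and a distribution on `ℂ²`. -/
def WeylSystem.HasDistribution₂ (S : WeylSystem P H) (f : (H →L[ℂ] H) →ₗ[ℂ] ℂ)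
    (Z Z' : Amplitude) (q : ℂ → ℂ → ℝ) : Prop :=
  ∀ τ τ' : ℂ, f (S.ordExp (conj τ • Z + conj τ' • Z')) =
    ∫ ξ : ℂ × ℂ, (q ξ.1 ξ.2 : ℂ) *
      cexp (I * ((2 * (conj τ * ξ.1 + conj τ' * ξ.2).re : ℝ) : ℂ))
      ∂((planeMeasure P.hbar).prod (planeMeasure P.hbar))

/-- The Markovian transition superoperator `M c = tr_{ℬ°} (ρ° c)` from `𝒜 ∨ ℬ°` to `𝒜`: the normal
positive normalized map with `M (a b°) = ⟨ρ°, b°⟩ a`. Here `𝒜` is generated by the amplitudes `A`,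
`ℬ°` by the amplitudes `B`. -/
structure WeylSystem.IsTransition (S : WeylSystem P H) (A B : Set Amplitude)
    (ρ : (H →L[ℂ] H) →ₗ[ℂ] ℂ) (M : (H →L[ℂ] H) →ₗ[ℂ] (H →L[ℂ] H)) : Prop where
  normal : ∀ f, IsNormalFunctional f → IsNormalFunctional (f ∘ₗ M)
  positive : ∀ c : H →L[ℂ] H, c.IsPositive → (M c).IsPositive
  map_one : M 1 = 1
  mapsTo : ∀ c ∈ S.algebra (A ∪ B), M c ∈ S.algebra A
  slice : ∀ a ∈ S.algebra A, ∀ b ∈ S.algebra B, M (a * b) = ρ b • a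

end States

/-! ### Data, dynamics, and a posteriori states -/

/-- The data `ζ = (u_0, η_1, u_1, …, η_k, u_k)` available at time `k`. -/
def History : ℕ → Type
  | 0 => ℂ
  | k + 1 => (History k × ℂ) × ℂ

instance instMeasurableSpaceHistory : ∀ k, MeasurableSpace (History k)
  | 0 => inferInstanceAs (MeasurableSpace ℂ)
  | k + 1 =>
    letI := instMeasurableSpaceHistory k
    inferInstanceAs (MeasurableSpace ((History k × ℂ) × ℂ))

/-- The last control `u_k` in the data. -/
def History.control : ∀ {k : ℕ}, History k → ℂ
  | 0, h => h
  | _ + 1, h => h.2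

/-- The data of the previous instant. -/
def History.prev {k : ℕ} (h : History (k + 1)) : History k := h.1.1

/-- The last measurement result `η_{k+1}`. -/
def History.outcome {k : ℕ} (h : History (k + 1)) : ℂ := h.1.2

/-- The amplitude `x_k`, for the controls applied so far:
`x_{k+1} = φ x_k + β u_k + v_{k+1}`, `x_0 = x`. -/
noncomputable def objectAmp (P : OscillatorParams) : ∀ k : ℕ, History k → Amplitude
  | 0, _ => Mode.x.amp
  | k + 1, h => P.φ • objectAmp P k h.prev + constAmp (P.β * h.prev.control) + (Mode.v k).amp

/-- The output amplitude `y_{k+1} = γ x_k + δ u_k + w_{k+1}`. -/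
noncomputable def outputAmp (P : OscillatorParams) (k : ℕ) (h : History k) : Amplitude :=
  P.γ • objectAmp P k h + constAmp (P.δ * h.control) + (Mode.w k).amp

section Filtering

variable {P : OscillatorParams} {H : Type*} [NormedAddCommGroup H]
  [InnerProductSpace ℂ H] [CompleteSpace H]

/-- The von Neumann algebra `𝒜_k`, generated by `x_k` (it does not depend on the controls, which
only shift `x_k` by a c-number). -/
def WeylSystem.objectAlgebra (S : WeylSystem P H) (k : ℕ) : Set (H →L[ℂ] H) :=
  S.algebra {Z | ∃ h : History k, Z = objectAmp P k h}

/-- `M` is the family of transition superoperators of the oscillator with the states `ρ k` of the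
noise `(v_{k+1}, w_{k+1})`: `M k` maps `𝒜_{k+1} ∨ ℬ_{k+1} ⊆ 𝒜_k ∨ ℬ°_{k+1}` to `𝒜_k`. -/
def WeylSystem.IsDynamics (S : WeylSystem P H) (ρ : ℕ → (H →L[ℂ] H) →ₗ[ℂ] ℂ)
    (M : ℕ → (H →L[ℂ] H) →ₗ[ℂ] (H →L[ℂ] H)) : Prop :=
  ∀ k, S.IsTransition {Z | ∃ h : History k, Z = objectAmp P k h}
    {(Mode.v k).amp, (Mode.w k).amp} (ρ k) (M k)

/-- The density `b η = #m (η - y)#` (with respect to `dη`) of the indirect measurement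
`b (dη) = #m (η - y)# dη`. -/
noncomputable def WeylSystem.measurement (S : WeylSystem P H) (m : ℂ → ℝ) (y : Amplitude)
    (η : ℂ) : H →L[ℂ] H :=
  S.symbolOp (fun ξ => (m (η - ξ) : ℂ)) y

/-- The density of the total state `π_k (dζ)` with respect to the measure `referenceMeasure` below:
`π_0 = π`, and `π_{k+1} (dζ × dη) = π_k (dζ) B (ζ, dη)`, where
`B (ζ, dη) a = M [b (ζ, dη) a]`. -/
noncomputable def WeylSystem.totalDensity (S : WeylSystem P H) (π₀ : (H →L[ℂ] H) →ₗ[ℂ] ℂ)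
    (M : ℕ → (H →L[ℂ] H) →ₗ[ℂ] (H →L[ℂ] H)) (m : ℕ → ℂ → ℝ) :
    ∀ k : ℕ, History k → (H →L[ℂ] H) →ₗ[ℂ] ℂ
  | 0, _ => π₀
  | k + 1, h =>
    S.totalDensity π₀ M m k h.prev ∘ₗ M k ∘ₗ
      LinearMap.mulLeft ℂ (S.measurement (m k) (outputAmp P k h.prev) h.outcome)

/-- The measure `∏ dη_{j+1} c_j (ζ, η_{j+1}; du_{j+1})` on the data, where the (possibly randomized)
control strategy chooses `u_{j+1}` by the law `c j` given the data at time `j` and the result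
`η_{j+1}`; the initial control `u₀` is fixed. -/
noncomputable def referenceMeasure (hbar : ℝ) (u₀ : ℂ)
    (c : ∀ k, Kernel (History k × ℂ) ℂ) : ∀ k : ℕ, Measure (History k)
  | 0 => Measure.dirac (α := ℂ) u₀
  | k + 1 => ((referenceMeasure hbar u₀ c k).prod (planeMeasure hbar)) ⊗ₘ c k

/-- The law `⟨π_k (dζ), 1⟩` of the data. -/
noncomputable def WeylSystem.dataLaw (S : WeylSystem P H) (π₀ : (H →L[ℂ] H) →ₗ[ℂ] ℂ)
    (M : ℕ → (H →L[ℂ] H) →ₗ[ℂ] (H →L[ℂ] H)) (m : ℕ → ℂ → ℝ) (u₀ : ℂ)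
    (c : ∀ k, Kernel (History k × ℂ) ℂ) (k : ℕ) : Measure (History k) :=
  (referenceMeasure P.hbar u₀ c k).withDensity
    fun h => ENNReal.ofReal (S.totalDensity π₀ M m k h 1).re

/-- `ϖ` is (a version of) the a posteriori state at time `k`: the Radon-Nikodym derivative of the
total state `π_k (dζ)` by the law `⟨π_k (dζ), 1⟩` of the data, in the weak sense on `𝒜_k`: the values
are in the predual, and `π_k (E) a = ∫_E ⟨ϖ (ζ), a⟩ ⟨π_k (dζ), 1⟩`. -/
def WeylSystem.IsAPosteriori (S : WeylSystem P H) (π₀ : (H →L[ℂ] H) →ₗ[ℂ] ℂ)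
    (M : ℕ → (H →L[ℂ] H) →ₗ[ℂ] (H →L[ℂ] H)) (m : ℕ → ℂ → ℝ) (u₀ : ℂ)
    (c : ∀ k, Kernel (History k × ℂ) ℂ) (k : ℕ)
    (ϖ : History k → (H →L[ℂ] H) →ₗ[ℂ] ℂ) : Prop :=
  (∀ h, IsNormalFunctional (ϖ h)) ∧
  ∀ a ∈ S.objectAlgebra k,
    AEStronglyMeasurable (fun h => ϖ h a) (S.dataLaw π₀ M m u₀ c k) ∧
    ∀ E : Set (History k), MeasurableSet E →
      ∫ h in E, ϖ h a ∂(S.dataLaw π₀ M m u₀ c k) =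
        ∫ h in E, S.totalDensity π₀ M m k h a ∂(referenceMeasure P.hbar u₀ c k)

end Filtering

/-! ### Gaussian distributions and the complex Kalman filter -/

/-- Parameters of the Gaussian distributions: mean `z` and variance `S₀` (in units of `ħ`) of the
initial state, `σ`, `ν`, `υ` of the noise, and `μ` of the indirect measurement. -/
structure GaussianParams where
  z : ℂ
  S₀ : ℝ
  σ : ℝ
  ν : ℝ
  υ : ℂ
  μ : ℝ

/-- `(1 / s) exp (- |ξ - z|² / (ħ s))`. -/
noncomputable def complexGaussian (hbar : ℝ) (z : ℂ) (s : ℝ) (ξ : ℂ) : ℝ :=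
  1 / s * Real.exp (-(‖ξ - z‖ ^ 2) / (hbar * s))

/-- The Gaussian distribution on `ℂ²` with covariance matrix `ħ [[σ, -υ], [-conj υ, ν]]`. -/
noncomputable def noiseGaussian (hbar : ℝ) (G : GaussianParams) (ξ η : ℂ) : ℝ :=
  Real.exp (-(G.ν * ‖ξ‖ ^ 2 + 2 * (G.υ * conj ξ * η).re + G.σ * ‖η‖ ^ 2) /
      (hbar * (G.σ * G.ν - ‖G.υ‖ ^ 2))) / (G.σ * G.ν - ‖G.υ‖ ^ 2)

/-- `Ψ = |γ|² s + ν + μ`. -/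
noncomputable def innovationVar (P : OscillatorParams) (G : GaussianParams) (s : ℝ) : ℝ :=
  ‖P.γ‖ ^ 2 * s + (G.ν + G.μ)

/-- `κ = (φ (conj γ) s - υ) / Ψ`. -/
noncomputable def kalmanGain (P : OscillatorParams) (G : GaussianParams) (s : ℝ) : ℂ :=
  (P.φ * conj P.γ * s - G.υ) / innovationVar P G s

/-- `Σ_{k+1} = |φ|² Σ_k + σ - |κ_{k+1}|² Ψ_{k+1}`, `Σ_0 = S₀`. -/
noncomputable def filterVar (P : OscillatorParams) (G : GaussianParams) : ℕ → ℝ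
  | 0 => G.S₀
  | k + 1 => ‖P.φ‖ ^ 2 * filterVar P G k + G.σ -
      ‖kalmanGain P G (filterVar P G k)‖ ^ 2 * innovationVar P G (filterVar P G k)

/-- `z_{k+1} = φ z_k + β u_k + κ_{k+1} (η_{k+1} - γ z_k - δ u_k)`, `z_0 = z`. -/
noncomputable def filterMean (P : OscillatorParams) (G : GaussianParams) :
    ∀ k : ℕ, History k → ℂ
  | 0, _ => G.z
  | k + 1, h => P.φ * filterMean P G k h.prev + P.β * h.prev.control +
      kalmanGain P G (filterVar P G k) *
        (h.outcome - P.γ * filterMean P G k h.prev - P.δ * h.prev.control)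

/-! ### Gaussian integrals on the complex plane -/

theorem ofReal_two_mul_re (z : ℂ) : ((2 * z.re : ℝ) : ℂ) = z + conj z :=
  (Complex.add_conj z).symm

theorem integrable_plane_gaussian {b : ℝ} (hb : 0 < b) (τ : ℂ) :
    Integrable fun ξ : ℂ => cexp (-(b : ℂ) * (‖ξ‖ : ℂ) ^ 2 +
      I * ((2 * (conj τ * ξ).re : ℝ) : ℂ)) := by
  have h := GaussianFourier.integrable_cexp_neg_mul_sq_norm_add (V := ℂ) (b := (b : ℂ))
    (by simpa using hb) (2 * I) τ
  refine h.congr (Filter.Eventually.of_forall fun ξ => ?_)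
  simp only [Complex.inner, mul_comm ξ]
  push_cast
  ring_nf

theorem integral_plane_gaussian {b : ℝ} (hb : 0 < b) (τ : ℂ) :
    ∫ ξ : ℂ, cexp (-(b : ℂ) * (‖ξ‖ : ℂ) ^ 2 + I * ((2 * (conj τ * ξ).re : ℝ) : ℂ)) =
      (Real.pi / b : ℂ) * cexp (-((‖τ‖ : ℂ) ^ 2) / b) := by
  have h := GaussianFourier.integral_cexp_neg_mul_sq_norm_add (V := ℂ) (b := (b : ℂ))
    (by simpa using hb) (2 * I) τ
  have hb' : (b : ℂ) ≠ 0 := by exact_mod_cast hb.ne'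
  have e : (2 * I) ^ 2 * (‖τ‖ : ℂ) ^ 2 / (4 * b) = -((‖τ‖ : ℂ) ^ 2) / b := by
    rw [mul_pow, I_sq]
    field_simp
    ring
  rw [Complex.finrank_real_complex, e] at h
  rw [show ((2 : ℕ) : ℂ) / 2 = 1 by norm_num, cpow_one] at h
  rw [← h]
  refine integral_congr_ae (Filter.Eventually.of_forall fun ξ => ?_)
  simp only [Complex.inner, mul_comm ξ]
  push_cast
  ring_nf

theorem integral_planeMeasure {E : Type*} [NormedAddCommGroup E] [NormedSpace ℝ E]
    {hbar : ℝ} (hh : 0 < hbar) (f : ℂ → E) :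
    ∫ ξ, f ξ ∂planeMeasure hbar = (1 / (Real.pi * hbar)) • ∫ ξ, f ξ := by
  rw [planeMeasure, integral_smul_measure, ENNReal.toReal_ofReal (by positivity)]

theorem integrable_planeMeasure {E : Type*} [NormedAddCommGroup E] {hbar : ℝ} {f : ℂ → E}
    (hf : Integrable f) : Integrable f (planeMeasure hbar) :=
  hf.smul_measure ENNReal.ofReal_ne_top

theorem complexGaussian_pos {hbar s : ℝ} (hs : 0 < s) (z ξ : ℂ) :
    0 < complexGaussian hbar z s ξ := by
  unfold complexGaussian
  positivity

theorem continuous_complexGaussian (hbar s : ℝ) :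
    Continuous fun q : ℂ × ℂ => complexGaussian hbar q.1 s q.2 := by
  unfold complexGaussian
  fun_prop

theorem complexGaussian_add_mul_cexp {hbar s : ℝ} (z τ ξ : ℂ) :
    (complexGaussian hbar z s (ξ + z) : ℂ) *
        cexp (I * ((2 * (conj τ * (ξ + z)).re : ℝ) : ℂ)) =
      cexp (I * ((2 * (conj τ * z).re : ℝ) : ℂ)) * (1 / s : ℂ) *
        cexp (-((1 / (hbar * s) : ℝ) : ℂ) * (‖ξ‖ : ℂ) ^ 2 +
          I * ((2 * (conj τ * ξ).re : ℝ) : ℂ)) := by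
  rw [complexGaussian, add_sub_cancel_right, mul_add, Complex.add_re]
  push_cast
  rw [mul_assoc, ← Complex.exp_add, mul_comm (cexp _) (1 / (s : ℂ)), mul_assoc, ← Complex.exp_add]
  congr 2
  ring

theorem integrable_complexGaussian_mul_cexp {hbar s : ℝ} (hh : 0 < hbar) (hs : 0 < s) (z τ : ℂ) :
    Integrable fun ξ : ℂ => (complexGaussian hbar z s ξ : ℂ) *
      cexp (I * ((2 * (conj τ * ξ).re : ℝ) : ℂ)) := by
  have h := ((integrable_plane_gaussian (b := 1 / (hbar * s)) (by positivity) τ).const_mul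
    (cexp (I * ((2 * (conj τ * z).re : ℝ) : ℂ)) * (1 / s : ℂ))).comp_sub_right z
  refine h.congr (Filter.Eventually.of_forall fun ξ => ?_)
  have h2 := complexGaussian_add_mul_cexp (hbar := hbar) (s := s) z τ (ξ - z)
  rw [sub_add_cancel] at h2
  exact h2.symm

theorem integral_complexGaussian_mul_cexp {hbar s : ℝ} (hh : 0 < hbar) (hs : 0 < s) (z τ : ℂ) :
    ∫ ξ : ℂ, (complexGaussian hbar z s ξ : ℂ) * cexp (I * ((2 * (conj τ * ξ).re : ℝ) : ℂ)) =
      (Real.pi * hbar : ℂ) * cexp (I * ((2 * (conj τ * z).re : ℝ) : ℂ) -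
        hbar * s * (‖τ‖ : ℂ) ^ 2) := by
  rw [← integral_add_right_eq_self _ z]
  simp only [complexGaussian_add_mul_cexp]
  rw [integral_const_mul, integral_plane_gaussian (by positivity), sub_eq_add_neg, Complex.exp_add]
  have h1 : (hbar : ℂ) ≠ 0 := by exact_mod_cast hh.ne'
  have h2 : (s : ℂ) ≠ 0 := by exact_mod_cast hs.ne'
  have e : -((‖τ‖ : ℂ) ^ 2) / ((1 / (hbar * s) : ℝ) : ℂ) = -(hbar * s * (‖τ‖ : ℂ) ^ 2) := by
    push_cast
    field_simp
  rw [e]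
  push_cast
  field_simp

/-- The characteristic function of the complex Gaussian distribution. -/
theorem charFun_complexGaussian {hbar s : ℝ} (hh : 0 < hbar) (hs : 0 < s) (z τ : ℂ) :
    ∫ ξ : ℂ, (complexGaussian hbar z s ξ : ℂ) * cexp (I * ((2 * (conj τ * ξ).re : ℝ) : ℂ))
        ∂planeMeasure hbar =
      cexp (I * ((2 * (conj τ * z).re : ℝ) : ℂ) - hbar * s * (‖τ‖ : ℂ) ^ 2) := by
  rw [integral_planeMeasure hh, integral_complexGaussian_mul_cexp hh hs, real_smul, ← mul_assoc]
  have h1 : (hbar : ℂ) ≠ 0 := by exact_mod_cast hh.ne'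
  have h2 : (Real.pi : ℂ) ≠ 0 := by exact_mod_cast Real.pi_ne_zero
  push_cast
  rw [one_div_mul_cancel (mul_ne_zero h2 h1), one_mul]

theorem integrable_complexGaussian {hbar s : ℝ} (hh : 0 < hbar) (hs : 0 < s) (z : ℂ) :
    Integrable (complexGaussian hbar z s) := by
  have h := (integrable_complexGaussian_mul_cexp hh hs z 0).re
  refine h.congr (Filter.Eventually.of_forall fun ξ => ?_)
  simp

theorem lintegral_complexGaussian {hbar s : ℝ} (hh : 0 < hbar) (hs : 0 < s) (z : ℂ) :
    ∫⁻ ξ, ENNReal.ofReal (complexGaussian hbar z s ξ) ∂planeMeasure hbar = 1 := by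
  have h := charFun_complexGaussian hh hs z 0
  simp only [map_zero, zero_mul, Complex.zero_re, mul_zero, ofReal_zero, Complex.exp_zero,
    mul_one, norm_zero, ne_eq, OfNat.ofNat_ne_zero, not_false_eq_true, zero_pow, sub_zero] at h
  rw [integral_complex_ofReal] at h
  rw [← ofReal_integral_eq_lintegral_ofReal (integrable_planeMeasure
    (integrable_complexGaussian hh hs z)) (Filter.Eventually.of_forall fun ξ =>
      (complexGaussian_pos hs z ξ).le)]
  rw [show ∫ ξ, complexGaussian hbar z s ξ ∂planeMeasure hbar = 1 by exact_mod_cast h]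
  simp

theorem complexGaussian_sub_comm (hbar s : ℝ) (η ξ : ℂ) :
    complexGaussian hbar 0 s (η - ξ) = complexGaussian hbar η s ξ := by
  rw [complexGaussian, complexGaussian, sub_zero, norm_sub_rev]

theorem planeFourier_complexGaussian {hbar s : ℝ} (hh : 0 < hbar) (hs : 0 < s) (η τ : ℂ) :
    planeFourier (fun ξ => (complexGaussian hbar 0 s (η - ξ) : ℂ)) τ =
      (hbar / Real.pi : ℂ) * cexp (-(I * ((2 * (conj τ * η).re : ℝ) : ℂ)) -
        hbar * s * (‖τ‖ : ℂ) ^ 2) := by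
  have h := integral_complexGaussian_mul_cexp hh hs η (-τ)
  have e : ∀ ξ : ℂ, I * ((2 * (conj (-τ) * ξ).re : ℝ) : ℂ) =
      -(I * ((2 * (conj τ * ξ).re : ℝ) : ℂ)) := by
    intro ξ
    rw [map_neg, neg_mul, Complex.neg_re]
    push_cast
    ring
  simp only [e, norm_neg] at h
  simp only [planeFourier, complexGaussian_sub_comm, h]
  have h2 : (Real.pi : ℂ) ≠ 0 := by exact_mod_cast Real.pi_ne_zero
  field_simp

theorem nu_pos {G : GaussianParams} (hσ : 0 < G.σ) (hυ : ‖G.υ‖ ^ 2 < G.σ * G.ν) : 0 < G.ν := by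
  by_contra h
  nlinarith [sq_nonneg ‖G.υ‖]

theorem noiseGaussian_eq_mul {hbar : ℝ} (hh : 0 < hbar) {G : GaussianParams} (hσ : 0 < G.σ)
    (hυ : ‖G.υ‖ ^ 2 < G.σ * G.ν) (ξ η : ℂ) :
    noiseGaussian hbar G ξ η =
      complexGaussian hbar (-(G.υ * η) / G.ν) ((G.σ * G.ν - ‖G.υ‖ ^ 2) / G.ν) ξ *
        complexGaussian hbar 0 G.ν η := by
  have hν := nu_pos hσ hυ
  have hD : 0 < G.σ * G.ν - ‖G.υ‖ ^ 2 := by linarith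
  have key : ‖ξ - -(G.υ * η) / G.ν‖ ^ 2 =
      ‖ξ‖ ^ 2 + 2 * (G.υ * conj ξ * η).re / G.ν + ‖G.υ‖ ^ 2 * ‖η‖ ^ 2 / G.ν ^ 2 := by
    have hν' : (G.ν : ℂ) ≠ 0 := by exact_mod_cast hν.ne'
    have h : ((‖ξ - -(G.υ * η) / G.ν‖ ^ 2 : ℝ) : ℂ) =
      ((‖ξ‖ ^ 2 + 2 * (G.υ * conj ξ * η).re / G.ν + ‖G.υ‖ ^ 2 * ‖η‖ ^ 2 / G.ν ^ 2 : ℝ) : ℂ) := by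
      rw [ofReal_add, ofReal_add, ofReal_div, ofReal_two_mul_re]
      push_cast
      simp only [← Complex.mul_conj', map_sub, map_neg, map_mul, map_div₀, Complex.conj_conj,
        Complex.conj_ofReal]
      field_simp
      ring
    exact_mod_cast h
  simp only [noiseGaussian, complexGaussian]
  set D := G.σ * G.ν - ‖G.υ‖ ^ 2 with hDdef
  have hσe : G.σ = (D + ‖G.υ‖ ^ 2) / G.ν := by
    rw [hDdef]
    field_simp
    ring
  rw [mul_mul_mul_comm, ← Real.exp_add, key, sub_zero, div_eq_mul_inv, mul_comm]
  congr 1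
  · field_simp
  · congr 1
    rw [hσe]
    field_simp
    ring

theorem charFun_noiseGaussian {hbar : ℝ} (hh : 0 < hbar) {G : GaussianParams} (hσ : 0 < G.σ)
    (hυ : ‖G.υ‖ ^ 2 < G.σ * G.ν) (τ τ' : ℂ) :
    ∫ ξ : ℂ × ℂ, (noiseGaussian hbar G ξ.1 ξ.2 : ℂ) *
      cexp (I * ((2 * (conj τ * ξ.1 + conj τ' * ξ.2).re : ℝ) : ℂ))
      ∂((planeMeasure hbar).prod (planeMeasure hbar)) =
    cexp (-(hbar * (G.σ * (‖τ‖ : ℂ) ^ 2 - ((2 * (G.υ * conj τ * τ').re : ℝ) : ℂ) +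
      G.ν * (‖τ'‖ : ℂ) ^ 2))) := by
  have hν := nu_pos hσ hυ
  have hD : 0 < (G.σ * G.ν - ‖G.υ‖ ^ 2) / G.ν := div_pos (by linarith) hν
  have hν' : (G.ν : ℂ) ≠ 0 := by exact_mod_cast hν.ne'
  have : SFinite (planeMeasure hbar) := by unfold planeMeasure; infer_instance
  have hcont : Continuous fun ξ : ℂ × ℂ => (noiseGaussian hbar G ξ.1 ξ.2 : ℂ) *
      cexp (I * ((2 * (conj τ * ξ.1 + conj τ' * ξ.2).re : ℝ) : ℂ)) := by
    unfold noiseGaussian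
    fun_prop
  have hone : ∀ z : ℂ, ∀ s : ℝ, 0 < s →
      ∫ ξ, complexGaussian hbar z s ξ ∂planeMeasure hbar = 1 := by
    intro z s hs
    have h := charFun_complexGaussian hh hs z 0
    simp only [map_zero, zero_mul, Complex.zero_re, mul_zero, ofReal_zero, Complex.exp_zero,
      mul_one, norm_zero, ne_eq, OfNat.ofNat_ne_zero, not_false_eq_true, zero_pow, sub_zero] at h
    rw [integral_complex_ofReal] at h
    exact_mod_cast h
  have hint : Integrable (fun ξ : ℂ × ℂ => (noiseGaussian hbar G ξ.1 ξ.2 : ℂ) *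
      cexp (I * ((2 * (conj τ * ξ.1 + conj τ' * ξ.2).re : ℝ) : ℂ)))
      ((planeMeasure hbar).prod (planeMeasure hbar)) := by
    have hnorm : ∀ ξ : ℂ × ℂ, ‖(noiseGaussian hbar G ξ.1 ξ.2 : ℂ) *
        cexp (I * ((2 * (conj τ * ξ.1 + conj τ' * ξ.2).re : ℝ) : ℂ))‖ =
        complexGaussian hbar (-(G.υ * ξ.2) / G.ν) ((G.σ * G.ν - ‖G.υ‖ ^ 2) / G.ν) ξ.1 *
        complexGaussian hbar 0 G.ν ξ.2 := by
      intro ξ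
      rw [norm_mul, mul_comm I, Complex.norm_exp_ofReal_mul_I, mul_one, Complex.norm_real,
        noiseGaussian_eq_mul hh hσ hυ, Real.norm_of_nonneg]
      exact mul_nonneg (complexGaussian_pos hD _ _).le (complexGaussian_pos hν _ _).le
    rw [integrable_prod_iff' hcont.aestronglyMeasurable]
    constructor
    · refine Filter.Eventually.of_forall fun η => ?_
      refine ((integrable_planeMeasure (hbar := hbar) (integrable_complexGaussian hh hD
        (-(G.υ * η) / G.ν))).mul_const (complexGaussian hbar 0 G.ν η)).mono'
          (hcont.comp (by fun_prop : Continuous fun ξ : ℂ => (ξ, η))).aestronglyMeasurable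
          (Filter.Eventually.of_forall fun ξ => (hnorm (ξ, η)).le)
    · refine (integrable_planeMeasure (integrable_complexGaussian hh hν 0)).congr
        (Filter.Eventually.of_forall fun η => ?_)
      have h : ∀ ξ : ℂ, _ := fun ξ => hnorm (ξ, η)
      simp only at h ⊢
      simp only [h, integral_mul_const, hone _ _ hD, one_mul]
  rw [integral_prod_symm _ hint]
  have hinner : ∀ η : ℂ, ∫ ξ, (noiseGaussian hbar G ξ η : ℂ) *
      cexp (I * ((2 * (conj τ * ξ + conj τ' * η).re : ℝ) : ℂ)) ∂planeMeasure hbar =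
      cexp (-(hbar * ((G.σ * G.ν - ‖G.υ‖ ^ 2) / G.ν : ℝ) * (‖τ‖ : ℂ) ^ 2)) *
      ((complexGaussian hbar 0 G.ν η : ℂ) *
        cexp (I * ((2 * (conj (τ' - τ * conj G.υ / G.ν) * η).re : ℝ) : ℂ))) := by
    intro η
    have e : ∀ ξ, (noiseGaussian hbar G ξ η : ℂ) *
        cexp (I * ((2 * (conj τ * ξ + conj τ' * η).re : ℝ) : ℂ)) =
        ((complexGaussian hbar 0 G.ν η : ℂ) *
          cexp (I * ((2 * (conj τ' * η).re : ℝ) : ℂ))) *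
        ((complexGaussian hbar (-(G.υ * η) / G.ν) ((G.σ * G.ν - ‖G.υ‖ ^ 2) / G.ν) ξ : ℂ) *
          cexp (I * ((2 * (conj τ * ξ).re : ℝ) : ℂ))) := by
      intro ξ
      rw [noiseGaussian_eq_mul hh hσ hυ, Complex.add_re, mul_add, ofReal_add, mul_add,
        Complex.exp_add]
      push_cast
      ring
    simp only [e]
    rw [integral_const_mul, charFun_complexGaussian hh hD, mul_assoc, mul_left_comm (cexp _) (Complex.ofReal _), ← Complex.exp_add, ← Complex.exp_add]
    congr 2
    simp only [ofReal_two_mul_re]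
    simp only [map_sub, map_neg, map_mul, map_div₀, Complex.conj_conj, Complex.conj_ofReal]
    field_simp
    ring
  simp only [hinner]
  rw [integral_const_mul, charFun_complexGaussian hh hν, ← Complex.exp_add]
  congr 1
  simp only [ofReal_two_mul_re]
  push_cast
  simp only [← Complex.mul_conj', map_sub, map_mul, map_div₀, map_zero, mul_zero,
    add_zero, Complex.conj_conj, Complex.conj_ofReal]
  field_simp
  ring

/-! ### The Kalman filter -/

theorem innovationVar_pos (P : OscillatorParams) {G : GaussianParams} (hσ : 0 < G.σ)
    (hυ : ‖G.υ‖ ^ 2 < G.σ * G.ν) (hμ : 0 < G.μ) {s : ℝ} (hs : 0 < s) :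
    0 < innovationVar P G s := by
  have hν := nu_pos hσ hυ
  unfold innovationVar
  positivity

theorem filterVar_pos (P : OscillatorParams) {G : GaussianParams} (hS₀ : 0 < G.S₀) (hσ : 0 < G.σ)
    (hυ : ‖G.υ‖ ^ 2 < G.σ * G.ν) (hμ : 0 < G.μ) (k : ℕ) : 0 < filterVar P G k := by
  induction k with
  | zero => exact hS₀
  | succ k ih =>
    rw [filterVar]
    set s := filterVar P G k
    have hΨ := innovationVar_pos P hσ hυ hμ ih
    have hν := nu_pos hσ hυ
    have e : ‖kalmanGain P G s‖ ^ 2 * innovationVar P G s =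
        ‖P.φ * conj P.γ * s - G.υ‖ ^ 2 / innovationVar P G s := by
      rw [kalmanGain, norm_div, div_pow, Complex.norm_real, Real.norm_of_nonneg hΨ.le]
      field_simp
    rw [e, sub_pos, div_lt_iff₀ hΨ]
    have key : ‖P.φ * conj P.γ * s - G.υ‖ ^ 2 ≤
        (‖P.φ‖ ^ 2 * s + G.σ) * (‖P.γ‖ ^ 2 * s + G.ν) - (G.σ * G.ν - ‖G.υ‖ ^ 2) := by
      have h1 : ‖P.φ * conj P.γ * s - G.υ‖ ≤ ‖P.φ‖ * ‖P.γ‖ * s + ‖G.υ‖ := by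
        refine (norm_sub_le _ _).trans ?_
        rw [norm_mul, norm_mul, RCLike.norm_conj, Complex.norm_real, Real.norm_of_nonneg ih.le]
      have h2 := pow_le_pow_left₀ (norm_nonneg _) h1 2
      have h3 : 2 * (‖P.φ‖ * ‖P.γ‖ * ‖G.υ‖) ≤ ‖P.φ‖ ^ 2 * G.ν + G.σ * ‖P.γ‖ ^ 2 := by
        have h4 : ‖P.φ‖ * ‖P.γ‖ * ‖G.υ‖ ≤ ‖P.φ‖ * ‖P.γ‖ * (√G.σ * √G.ν) := by
          have : ‖G.υ‖ ≤ √G.σ * √G.ν := by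
            rw [← Real.sqrt_mul hσ.le]
            exact Real.le_sqrt_of_sq_le hυ.le
          gcongr
        nlinarith [sq_nonneg (‖P.φ‖ * √G.ν - √G.σ * ‖P.γ‖), Real.sq_sqrt hσ.le, Real.sq_sqrt hν.le]
      nlinarith
    have h5 : 0 < (‖P.φ‖ ^ 2 * s + G.σ) * G.μ := by positivity
    rw [innovationVar]
    nlinarith

/-- The Bayes formula for the Gaussian distributions in terms of characteristic functions. -/
theorem kalman_integral {hbar : ℝ} (hh : 0 < hbar) (P : OscillatorParams) (G : GaussianParams)
    {S : ℝ} (hΨ : 0 < innovationVar P G S) (z u η τ : ℂ) :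
    ∫ s : ℂ, ((hbar / Real.pi : ℂ) * cexp (-(I * ((2 * (conj s * η).re : ℝ) : ℂ)) -
        hbar * G.μ * (‖s‖ : ℂ) ^ 2)) *
      (cexp (I * ((2 * (conj s * (P.δ * u) + conj τ * (P.β * u)).re : ℝ) : ℂ)) *
      (cexp (I * ((2 * ((conj s * P.γ + conj τ * P.φ) * z).re : ℝ) : ℂ) -
          hbar * S * (‖conj s * P.γ + conj τ * P.φ‖ : ℂ) ^ 2) *
      cexp (-(hbar * (G.σ * (‖τ‖ : ℂ) ^ 2 - ((2 * (G.υ * conj τ * s).re : ℝ) : ℂ) +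
        G.ν * (‖s‖ : ℂ) ^ 2))))) =
    (complexGaussian hbar 0 (innovationVar P G S) (η - P.γ * z - P.δ * u) : ℂ) *
      cexp (I * ((2 * (conj τ * (P.φ * z + P.β * u +
          kalmanGain P G S * (η - P.γ * z - P.δ * u))).re : ℝ) : ℂ) -
        hbar * ((‖P.φ‖ ^ 2 * S + G.σ - ‖kalmanGain P G S‖ ^ 2 * innovationVar P G S : ℝ) : ℂ) *
          (‖τ‖ : ℂ) ^ 2) := by
  have hΨ' : (innovationVar P G S : ℂ) ≠ 0 := by exact_mod_cast hΨ.ne'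
  have hh' : (hbar : ℂ) ≠ 0 := by exact_mod_cast hh.ne'
  have hK : kalmanGain P G S * innovationVar P G S = P.φ * conj P.γ * S - G.υ :=
    div_mul_cancel₀ _ hΨ'
  have hK' : conj (kalmanGain P G S) * innovationVar P G S = conj P.φ * P.γ * S - conj G.υ := by
    have h := congrArg conj hK
    simpa only [map_sub, map_mul, Complex.conj_conj, Complex.conj_ofReal] using h
  have hV : (innovationVar P G S : ℂ) = P.γ * conj P.γ * S + (G.ν + G.μ) := by
    rw [innovationVar]
    push_cast
    rw [Complex.mul_conj']
  set κ := kalmanGain P G S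
  set Ψ := innovationVar P G S
  set e := η - P.γ * z - P.δ * u with he
  have hexp : ∀ s : ℂ, ((hbar / Real.pi : ℂ) * cexp (-(I * ((2 * (conj s * η).re : ℝ) : ℂ)) -
        hbar * G.μ * (‖s‖ : ℂ) ^ 2)) *
      (cexp (I * ((2 * (conj s * (P.δ * u) + conj τ * (P.β * u)).re : ℝ) : ℂ)) *
      (cexp (I * ((2 * ((conj s * P.γ + conj τ * P.φ) * z).re : ℝ) : ℂ) -
          hbar * S * (‖conj s * P.γ + conj τ * P.φ‖ : ℂ) ^ 2) *
      cexp (-(hbar * (G.σ * (‖τ‖ : ℂ) ^ 2 - ((2 * (G.υ * conj τ * s).re : ℝ) : ℂ) +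
        G.ν * (‖s‖ : ℂ) ^ 2))))) =
      ((hbar / Real.pi : ℂ) * cexp (I * ((2 * (conj τ * (P.φ * z + P.β * u + κ * e)).re : ℝ) : ℂ) -
        hbar * ((‖P.φ‖ ^ 2 * S + G.σ - ‖κ‖ ^ 2 * Ψ : ℝ) : ℂ) * (‖τ‖ : ℂ) ^ 2)) *
      cexp (-((hbar * Ψ : ℝ) : ℂ) * (‖s + τ * conj κ‖ : ℂ) ^ 2 +
        I * ((2 * (conj (-e) * (s + τ * conj κ)).re : ℝ) : ℂ)) := by
    intro s
    rw [mul_assoc (_ / _), mul_assoc (_ / _), ← Complex.exp_add, ← Complex.exp_add,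
      ← Complex.exp_add, ← Complex.exp_add]
    congr 2
    simp only [ofReal_two_mul_re]
    push_cast
    simp only [← Complex.mul_conj', he, map_add, map_sub, map_neg, map_mul, Complex.conj_conj]
    linear_combination ((hbar : ℂ) * s * conj s) * hV + (hbar * s * conj τ) * hK
      + (hbar * conj s * τ) * hK'
  simp only [hexp]
  rw [integral_const_mul, integral_add_right_eq_self (fun s : ℂ =>
    cexp (-((hbar * Ψ : ℝ) : ℂ) * (‖s‖ : ℂ) ^ 2 + I * ((2 * (conj (-e) * s).re : ℝ) : ℂ))),
    integral_plane_gaussian (by positivity)]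
  have h2 : (Real.pi : ℂ) ≠ 0 := by exact_mod_cast Real.pi_ne_zero
  rw [complexGaussian, norm_neg, sub_zero]
  push_cast
  field_simp

/-! ### Commutators of amplitudes -/

section Commutators

variable (P : OscillatorParams)

theorem ampCommutator_eq_sum {s t : Finset Mode} {Z Z' : Mode →₀ ℂ} (hs : Z.support ⊆ s)
    (ht : Z'.support ⊆ t) : ampCommutator P Z Z' =
      P.hbar * ∑ i ∈ s, ∑ j ∈ t, Z i * conj (Z' j) * modeCommutator P i j := by
  unfold ampCommutator
  rw [Finsupp.sum_of_support_subset _ hs _ (by simp)]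
  congr 1
  refine Finset.sum_congr rfl fun i _ => ?_
  rw [Finsupp.sum_of_support_subset _ ht _ (by simp)]

theorem ampCommutator_add_left (X Y Z : Mode →₀ ℂ) :
    ampCommutator P (X + Y) Z = ampCommutator P X Z + ampCommutator P Y Z := by
  classical
  rw [ampCommutator_eq_sum P (Finsupp.support_add) subset_rfl,
    ampCommutator_eq_sum P (Finset.subset_union_left (s₂ := Y.support)) subset_rfl,
    ampCommutator_eq_sum P (Finset.subset_union_right (s₁ := X.support)) subset_rfl,
    ← mul_add, ← Finset.sum_add_distrib]
  simp only [← Finset.sum_add_distrib, Finsupp.add_apply, add_mul]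

theorem modeCommutator_conj (i j : Mode) :
    conj (modeCommutator P i j) = modeCommutator P j i := by
  cases i <;> cases j <;> simp only [modeCommutator, eq_comm] <;> (try split_ifs) <;>
    simp [mul_comm]

theorem ampCommutator_conj (X Y : Mode →₀ ℂ) :
    conj (ampCommutator P X Y) = ampCommutator P Y X := by
  simp only [ampCommutator, Finsupp.sum, map_mul, map_sum, Complex.conj_ofReal, Complex.conj_conj,
    modeCommutator_conj]
  rw [Finset.sum_comm]
  congr 1
  refine Finset.sum_congr rfl fun i _ => Finset.sum_congr rfl fun j _ => ?_
  ring

theorem ampCommutator_smul_left (c : ℂ) (X Y : Mode →₀ ℂ) :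
    ampCommutator P (c • X) Y = c * ampCommutator P X Y := by
  rw [ampCommutator_eq_sum P (Finsupp.support_smul (b := c) (g := X)) subset_rfl,
    ampCommutator_eq_sum P subset_rfl subset_rfl, mul_left_comm]
  simp only [Finset.mul_sum, Finsupp.smul_apply, smul_eq_mul, mul_assoc]

theorem ampCommutator_add_right (X Y Z : Mode →₀ ℂ) :
    ampCommutator P X (Y + Z) = ampCommutator P X Y + ampCommutator P X Z := by
  rw [← ampCommutator_conj, ampCommutator_add_left, map_add, ampCommutator_conj,
    ampCommutator_conj]

theorem ampCommutator_smul_right (c : ℂ) (X Y : Mode →₀ ℂ) :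
    ampCommutator P X (c • Y) = conj c * ampCommutator P X Y := by
  rw [← ampCommutator_conj, ampCommutator_smul_left, map_mul, ampCommutator_conj]

theorem ampCommutator_single (i j : Mode) :
    ampCommutator P (Finsupp.single i 1) (Finsupp.single j 1) =
      P.hbar * modeCommutator P i j := by
  simp [ampCommutator]

/-- The operator part of `x_k`. -/
noncomputable def objectVec : ℕ → (Mode →₀ ℂ)
  | 0 => Finsupp.single .x 1
  | k + 1 => P.φ • objectVec k + Finsupp.single (.v k) 1

/-- The operator part of `y_{k+1}`. -/
noncomputable def outputVec (k : ℕ) : Mode →₀ ℂ :=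
  P.γ • objectVec P k + Finsupp.single (.w k) 1

theorem objectAmp_snd (k : ℕ) (h : History k) : (objectAmp P k h).2 = objectVec P k := by
  induction k with
  | zero => rfl
  | succ k ih =>
    rw [objectAmp, objectVec, ← ih h.prev]
    simp [constAmp, Mode.amp]

theorem outputAmp_snd (k : ℕ) (h : History k) : (outputAmp P k h).2 = outputVec P k := by
  rw [outputAmp, outputVec, ← objectAmp_snd P k h]
  simp [constAmp, Mode.amp]

theorem ampCommutator_objectVec_v {k j : ℕ} (hkj : k ≤ j) :
    ampCommutator P (objectVec P k) (Finsupp.single (.v j) 1) = 0 := by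
  induction k with
  | zero => simp [objectVec, ampCommutator_single, modeCommutator]
  | succ k ih =>
    rw [objectVec, ampCommutator_add_left, ampCommutator_smul_left, ih (by omega),
      ampCommutator_single]
    simp [modeCommutator, show k ≠ j by omega]

theorem ampCommutator_objectVec_w {k j : ℕ} (hkj : k ≤ j) :
    ampCommutator P (objectVec P k) (Finsupp.single (.w j) 1) = 0 := by
  induction k with
  | zero => simp [objectVec, ampCommutator_single, modeCommutator]
  | succ k ih =>
    rw [objectVec, ampCommutator_add_left, ampCommutator_smul_left, ih (by omega),
      ampCommutator_single]
    simp [modeCommutator, show k ≠ j by omega]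

theorem ampCommutator_v_objectVec {k j : ℕ} (hkj : k ≤ j) :
    ampCommutator P (Finsupp.single (.v j) 1) (objectVec P k) = 0 := by
  rw [← ampCommutator_conj, ampCommutator_objectVec_v P hkj, map_zero]

theorem ampCommutator_w_objectVec {k j : ℕ} (hkj : k ≤ j) :
    ampCommutator P (Finsupp.single (.w j) 1) (objectVec P k) = 0 := by
  rw [← ampCommutator_conj, ampCommutator_objectVec_w P hkj, map_zero]

theorem ampCommutator_objectVec_self (k : ℕ) :
    ampCommutator P (objectVec P k) (objectVec P k) = P.hbar := by
  induction k with
  | zero => simp [objectVec, ampCommutator_single, modeCommutator]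
  | succ k ih =>
    simp only [objectVec, ampCommutator_add_left, ampCommutator_smul_left, ampCommutator_add_right,
      ampCommutator_smul_right, ih, ampCommutator_objectVec_v P le_rfl,
      ampCommutator_v_objectVec P le_rfl, ampCommutator_single, modeCommutator, if_true,
      ← Complex.mul_conj']
    ring

theorem ampCommutator_outputVec_self (k : ℕ) :
    ampCommutator P (outputVec P k) (outputVec P k) = P.hbar * P.ε := by
  simp only [outputVec, ampCommutator_add_left, ampCommutator_smul_left, ampCommutator_add_right,
    ampCommutator_smul_right, ampCommutator_objectVec_self, ampCommutator_objectVec_w P le_rfl,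
    ampCommutator_w_objectVec P le_rfl, ampCommutator_single, modeCommutator, if_true,
    ← Complex.mul_conj']
  ring

theorem ampCommutator_outputVec_objectVec (k : ℕ) :
    ampCommutator P (outputVec P k) (objectVec P (k + 1)) = 0 := by
  simp only [outputVec, objectVec, ampCommutator_add_left, ampCommutator_smul_left,
    ampCommutator_add_right, ampCommutator_smul_right, ampCommutator_objectVec_self,
    ampCommutator_objectVec_v P le_rfl, ampCommutator_w_objectVec P le_rfl, ampCommutator_single,
    modeCommutator, if_true]
  ring

end Commutators

/-! ### Products of Weyl operators and ordered exponentials -/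

section Products

variable {P : OscillatorParams} {H : Type*} [NormedAddCommGroup H]
  [InnerProductSpace ℂ H] [CompleteSpace H] (S : WeylSystem P H)

theorem WeylSystem.weylOp_mul (Z Z' : Amplitude) : S.weylOp Z * S.weylOp Z' =
    cexp (-(I * ((ampCommutator P Z.2 Z'.2).im : ℂ))) • S.weylOp (Z + Z') := by
  simp only [weylOp, smul_mul_smul_comm, S.weyl, smul_smul, ← Complex.exp_add, Prod.fst_add,
    Prod.snd_add, Complex.add_re]
  congr 2
  push_cast
  ring

theorem WeylSystem.ordExp_mul {Z Z' : Amplitude} (h : ampCommutator P Z.2 Z'.2 = 0) :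
    S.ordExp Z * S.ordExp Z' = S.ordExp (Z + Z') := by
  have h' : ampCommutator P Z'.2 Z.2 = 0 := by rw [← ampCommutator_conj, h, _root_.map_zero]
  simp only [ordExp, smul_mul_smul_comm, S.weylOp_mul, h, ← Complex.exp_add, Prod.snd_add,
    ampCommutator_add_left, ampCommutator_add_right, h', zero_im, ofReal_zero, mul_zero, neg_zero,
    Complex.exp_zero, one_smul, add_zero, zero_add, add_div]

theorem WeylSystem.ordExp_constAmp_add (d : ℂ) (Z : Amplitude) :
    S.ordExp (constAmp d + Z) = cexp (I * ((2 * d.re : ℝ) : ℂ)) • S.ordExp Z := by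
  simp only [ordExp, weylOp, constAmp, Prod.fst_add, Prod.snd_add, zero_add, smul_smul,
    ← Complex.exp_add, Complex.add_re]
  congr 2
  push_cast
  ring

theorem WeylSystem.smul_mem_algebra {A : Set Amplitude} {a : H →L[ℂ] H} (ha : a ∈ S.algebra A)
    (c : ℂ) : c • a ∈ S.algebra A :=
  Set.smul_mem_centralizer c ha

theorem WeylSystem.mul_mem_algebra {A : Set Amplitude} {a b : H →L[ℂ] H} (ha : a ∈ S.algebra A)
    (hb : b ∈ S.algebra A) : a * b ∈ S.algebra A :=
  Set.mul_mem_centralizer ha hb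

theorem WeylSystem.weylOp_mem_algebra {A : Set Amplitude} {Z : Amplitude} (hZ : Z ∈ A) (τ : ℂ) :
    S.weylOp (τ • Z) ∈ S.algebra A :=
  Set.subset_centralizer_centralizer ⟨Z, hZ, conj τ, by rw [Complex.conj_conj]⟩

theorem WeylSystem.ordExp_mem_algebra {A : Set Amplitude} {Z : Amplitude} (hZ : Z ∈ A) (τ : ℂ) :
    S.ordExp (τ • Z) ∈ S.algebra A :=
  S.smul_mem_algebra (S.weylOp_mem_algebra hZ τ) _

theorem WeylSystem.ordExp_add_mem_algebra {A : Set Amplitude} {Z Z' : Amplitude} (hZ : Z ∈ A)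
    (hZ' : Z' ∈ A) (τ τ' : ℂ) : S.ordExp (τ • Z + τ' • Z') ∈ S.algebra A := by
  have h := S.mul_mem_algebra (S.weylOp_mem_algebra hZ τ) (S.weylOp_mem_algebra hZ' τ')
  rw [S.weylOp_mul] at h
  have h2 := S.smul_mem_algebra h
    (cexp (-(I * ((ampCommutator P (τ • Z).2 (τ' • Z').2).im : ℂ))))⁻¹
  rw [smul_smul, inv_mul_cancel₀ (Complex.exp_ne_zero _), one_smul] at h2
  exact S.smul_mem_algebra h2 _

/-- The factorization of `#exp (i (s̄ y + τ̄ x'))#`, where `x'` is the next object amplitude. -/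
theorem WeylSystem.ordExp_output_mul_object (k : ℕ) (h : History (k + 1)) (s t : ℂ) :
    S.ordExp (s • outputAmp P k h.prev) * S.ordExp (t • objectAmp P (k + 1) h) =
      cexp (I * ((2 * (s * (P.δ * h.prev.control) + t * (P.β * h.prev.control)).re : ℝ) : ℂ)) •
        (S.ordExp ((s * P.γ + t * P.φ) • objectAmp P k h.prev) *
          S.ordExp (t • (Mode.v k).amp + s • (Mode.w k).amp)) := by
  rw [S.ordExp_mul, S.ordExp_mul, ← S.ordExp_constAmp_add]
  · congr 1
    rw [outputAmp, objectAmp]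
    ext <;> simp [constAmp, Mode.amp] <;> ring
  · simp only [Prod.smul_snd, Prod.snd_add, Mode.amp, objectAmp_snd, ampCommutator_smul_left,
      ampCommutator_add_right, ampCommutator_smul_right, ampCommutator_objectVec_v P le_rfl,
      ampCommutator_objectVec_w P le_rfl, mul_zero, add_zero]
  · simp only [Prod.smul_snd, outputAmp_snd, objectAmp_snd, ampCommutator_smul_left,
      ampCommutator_smul_right, ampCommutator_outputVec_objectVec, mul_zero]

theorem WeylSystem.ordExp_smul_eq (Z : Amplitude) (τ : ℂ) :
    S.ordExp (conj τ • Z) = (cexp (ampCommutator P (conj τ • Z.2) (conj τ • Z.2) / 2) *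
      cexp (I * ((2 * (conj τ * Z.1).re : ℝ) : ℂ))) • S.W (conj τ • Z.2) := by
  simp only [ordExp, weylOp, smul_smul, Prod.smul_snd, Prod.smul_fst, smul_eq_mul]

end Products

/-! ### Normal functionals -/

theorem integrable_mul_cexp {g : ℂ → ℂ} (hg : Integrable g) (t : ℂ) :
    Integrable fun τ => g τ * cexp (I * ((2 * (conj τ * t).re : ℝ) : ℂ)) := by
  refine hg.norm.mono' (hg.aestronglyMeasurable.mul
    (by fun_prop : Continuous fun τ : ℂ =>
      cexp (I * ((2 * (conj τ * t).re : ℝ) : ℂ))).aestronglyMeasurable) ?_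
  refine Filter.Eventually.of_forall fun τ => ?_
  rw [norm_mul, mul_comm I, Complex.norm_exp_ofReal_mul_I, mul_one]

section Normal

variable {H : Type*} [NormedAddCommGroup H]

theorem summable_norm_mul_norm {ψ χ : ℕ → H} (hψ : Summable fun n => ‖ψ n‖ ^ 2)
    (hχ : Summable fun n => ‖χ n‖ ^ 2) : Summable fun n => ‖ψ n‖ * ‖χ n‖ := by
  refine Summable.of_nonneg_of_le (fun n => by positivity) (fun n => ?_) (hψ.add hχ)
  nlinarith [two_mul_le_add_sq ‖ψ n‖ ‖χ n‖, sq_nonneg ‖ψ n‖, sq_nonneg ‖χ n‖]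

variable [InnerProductSpace ℂ H]

theorem norm_inner_apply_le (ψ χ : H) (a : H →L[ℂ] H) :
    ‖inner ℂ ψ (a χ)‖ ≤ ‖ψ‖ * ‖χ‖ * ‖a‖ := by
  refine (norm_inner_le_norm _ _).trans ?_
  rw [mul_assoc, mul_comm ‖χ‖]
  exact mul_le_mul_of_nonneg_left (a.le_opNorm _) (norm_nonneg _)

theorem summable_norm_sq_apply {χ : ℕ → H} (hχ : Summable fun n => ‖χ n‖ ^ 2) (a : H →L[ℂ] H) :
    Summable fun n => ‖a (χ n)‖ ^ 2 := by
  refine Summable.of_nonneg_of_le (fun n => by positivity) (fun n => ?_) (hχ.mul_left (‖a‖ ^ 2))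
  rw [← mul_pow]
  exact pow_le_pow_left₀ (norm_nonneg _) (a.le_opNorm _) 2

variable {f : (H →L[ℂ] H) →ₗ[ℂ] ℂ}

theorem IsNormalFunctional.exists_bound (hf : IsNormalFunctional f) :
    ∃ C, ∀ a, ‖f a‖ ≤ C * ‖a‖ := by
  obtain ⟨ψ, χ, hψ, hχ, h⟩ := hf
  refine ⟨∑' n, ‖ψ n‖ * ‖χ n‖, fun a => ?_⟩
  have hs := (summable_norm_mul_norm hψ hχ).mul_right ‖a‖
  rw [← (h a).tsum_eq, ← tsum_mul_right]
  exact tsum_of_norm_bounded hs.hasSum fun n => norm_inner_apply_le _ _ _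

theorem IsNormalFunctional.smul (hf : IsNormalFunctional f) (c : ℂ) :
    IsNormalFunctional (c • f) := by
  obtain ⟨ψ, χ, hψ, hχ, h⟩ := hf
  refine ⟨ψ, fun n => c • χ n, hψ, ?_, fun a => ?_⟩
  · simpa only [norm_smul, mul_pow] using hχ.mul_left (‖c‖ ^ 2)
  · simpa only [map_smul, inner_smul_right, LinearMap.smul_apply, smul_eq_mul] using (h a).mul_left c

theorem IsNormalFunctional.comp_mulRight (hf : IsNormalFunctional f) (b : H →L[ℂ] H) :
    IsNormalFunctional (f ∘ₗ LinearMap.mulRight ℂ b) := by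
  obtain ⟨ψ, χ, hψ, hχ, h⟩ := hf
  exact ⟨ψ, fun n => b (χ n), hψ, summable_norm_sq_apply hχ _, fun a => h (a * b)⟩

/-- The functional `a ↦ ⟨ψ, a χ⟩`. -/
noncomputable def matrixElement (ψ χ : H) : (H →L[ℂ] H) →ₗ[ℂ] ℂ where
  toFun a := inner ℂ ψ (a χ)
  map_add' a b := by simp
  map_smul' c a := by simp

theorem isNormalFunctional_matrixElement (ψ χ : H) :
    IsNormalFunctional (matrixElement ψ χ) := by
  have hs : ∀ ψ : H, Summable fun n => ‖(Pi.single 0 ψ : ℕ → H) n‖ ^ 2 := fun ψ =>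
    summable_of_ne_finset_zero (s := {0}) fun n hn => by
      rw [Pi.single_eq_of_ne (by simpa using hn)]
      simp
  refine ⟨Pi.single 0 ψ, Pi.single 0 χ, hs ψ, hs χ, fun a => ?_⟩
  have h := hasSum_single (f := fun n => inner ℂ ((Pi.single 0 ψ : ℕ → H) n)
    (a ((Pi.single 0 χ : ℕ → H) n))) 0 fun n hn => by simp [Pi.single_eq_of_ne hn]
  simp only [Pi.single_eq_same] at h
  exact h

theorem IsNormalFunctional.continuous_comp {X : Type*} [TopologicalSpace X]
    (hf : IsNormalFunctional f) {T : X → H →L[ℂ] H} (hT : ∀ χ, Continuous fun x => T x χ)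
    (hb : ∀ x χ, ‖T x χ‖ ≤ ‖χ‖) : Continuous fun x => f (T x) := by
  obtain ⟨ψ, χ, hψ, hχ, h⟩ := hf
  simp only [← fun x => (h (T x)).tsum_eq]
  refine continuous_tsum (fun n => Continuous.inner continuous_const (hT _))
    (summable_norm_mul_norm hψ hχ) fun n x => ?_
  exact (norm_inner_le_norm _ _).trans (mul_le_mul_of_nonneg_left (hb _ _) (norm_nonneg _))

variable [CompleteSpace H]

theorem IsNormalFunctional.comp_mulLeft (hf : IsNormalFunctional f) (b : H →L[ℂ] H) :
    IsNormalFunctional (f ∘ₗ LinearMap.mulLeft ℂ b) := by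
  obtain ⟨ψ, χ, hψ, hχ, h⟩ := hf
  refine ⟨fun n => ContinuousLinearMap.adjoint b (ψ n), χ, summable_norm_sq_apply hψ _, hχ,
    fun a => ?_⟩
  simp only [ContinuousLinearMap.adjoint_inner_left]
  exact h (b * a)

/-- A map that preserves normality under composition is bounded. -/
theorem continuous_of_normal {M : (H →L[ℂ] H) →ₗ[ℂ] (H →L[ℂ] H)}
    (hM : ∀ f, IsNormalFunctional f → IsNormalFunctional (f ∘ₗ M)) : Continuous M := by
  refine LinearMap.continuous_of_seq_closed_graph M fun u x y hu hMu => ?_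
  ext χ
  refine ext_inner_left ℂ fun ψ => ?_
  obtain ⟨C, hC⟩ := (hM _ (isNormalFunctional_matrixElement ψ χ)).exists_bound
  have hcont : Continuous (matrixElement ψ χ ∘ₗ M) :=
    AddMonoidHomClass.continuous_of_bound _ C hC
  have h1 := (hcont.tendsto x).comp hu
  have h2 : Filter.Tendsto (fun n => inner ℂ ψ (M (u n) χ)) Filter.atTop
      (nhds (inner ℂ ψ (y χ))) := by
    have : Continuous fun a : H →L[ℂ] H => inner ℂ ψ (a χ) := by fun_prop
    exact (this.tendsto y).comp hMu
  exact tendsto_nhds_unique h2 h1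

variable {P : OscillatorParams} (S : WeylSystem P H)

theorem WeylSystem.weylIntegral_apply {g : ℂ → ℂ} (hg : Integrable g) (Z : Amplitude) (ψ : H) :
    S.weylIntegral g Z ψ = ∫ τ : ℂ, g τ • S.weylOp (conj τ • Z) ψ := by
  rw [weylIntegral, dif_pos hg]
  rfl

theorem IsNormalFunctional.map_weylIntegral (hf : IsNormalFunctional f) {g : ℂ → ℂ}
    (hg : Integrable g) (Z : Amplitude) :
    f (S.weylIntegral g Z) = ∫ τ : ℂ, g τ * f (S.weylOp (conj τ • Z)) := by
  obtain ⟨ψ, χ, hψ, hχ, h⟩ := hf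
  have hF : ∀ n, Integrable fun τ : ℂ => inner ℂ (ψ n) (g τ • S.weylOp (conj τ • Z) (χ n)) :=
    fun n => (S.integrable_weylOp hg Z (χ n)).const_inner (ψ n)
  have hle : ∀ n τ, ‖inner ℂ (ψ n) (g τ • S.weylOp (conj τ • Z) (χ n))‖ ≤
      ‖g τ‖ * (‖ψ n‖ * ‖χ n‖) := by
    intro n τ
    refine (norm_inner_le_norm _ _).trans (le_of_eq ?_)
    rw [norm_smul, S.norm_weylOp]
    ring
  have hsum : Summable fun n =>
      ∫ τ : ℂ, ‖inner ℂ (ψ n) (g τ • S.weylOp (conj τ • Z) (χ n))‖ := by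
    refine Summable.of_nonneg_of_le (fun n => integral_nonneg fun τ => norm_nonneg _)
      (fun n => ?_) ((summable_norm_mul_norm hψ hχ).mul_left (∫ τ, ‖g τ‖))
    rw [← integral_mul_const]
    exact integral_mono (hF n).norm (hg.norm.mul_const _) (hle n)
  have h1 := hasSum_integral_of_summable_integral_norm hF hsum
  have h2 : ∀ n, ∫ τ : ℂ, inner ℂ (ψ n) (g τ • S.weylOp (conj τ • Z) (χ n)) =
      inner ℂ (ψ n) (S.weylIntegral g Z (χ n)) := by
    intro n
    rw [S.weylIntegral_apply hg, integral_inner (S.integrable_weylOp hg Z (χ n))]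
  simp only [h2] at h1
  rw [(h _).unique h1]
  refine integral_congr_ae (Filter.Eventually.of_forall fun τ => ?_)
  simp only [inner_smul_right]
  rw [tsum_mul_left, (h _).tsum_eq]

theorem WeylSystem.norm_weylIntegral_sub_le {g g' : ℂ → ℂ} (hg : Integrable g)
    (hg' : Integrable g') (Z : Amplitude) :
    ‖S.weylIntegral g Z - S.weylIntegral g' Z‖ ≤ ∫ τ, ‖g τ - g' τ‖ := by
  refine ContinuousLinearMap.opNorm_le_bound _ (integral_nonneg fun τ => norm_nonneg _) fun ψ => ?_
  rw [sub_apply, S.weylIntegral_apply hg, S.weylIntegral_apply hg',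
    ← integral_sub (S.integrable_weylOp hg Z ψ) (S.integrable_weylOp hg' Z ψ),
    ← integral_mul_const]
  refine (norm_integral_le_integral_norm _).trans (le_of_eq ?_)
  simp only [← sub_smul, norm_smul, S.norm_weylOp]

/-- The superposition of the displaced Weyl operators depends continuously (in norm) on the
displacement. -/
theorem WeylSystem.continuous_weylIntegral_displacement {g : ℂ → ℂ} (hg : Integrable g)
    (Z : Amplitude) : Continuous fun t : ℂ =>
      S.weylIntegral (fun τ => g τ * cexp (I * ((2 * (conj τ * t).re : ℝ) : ℂ))) Z := by
  have hint := integrable_mul_cexp hg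
  rw [continuous_iff_continuousAt]
  intro t₀
  rw [ContinuousAt, tendsto_iff_norm_sub_tendsto_zero]
  have hc : Continuous fun t : ℂ => ∫ τ, ‖g τ * cexp (I * ((2 * (conj τ * t).re : ℝ) : ℂ)) -
      g τ * cexp (I * ((2 * (conj τ * t₀).re : ℝ) : ℂ))‖ := by
    refine continuous_of_dominated (bound := fun τ => 2 * ‖g τ‖)
      (fun t => ((hint t).sub (hint t₀)).norm.aestronglyMeasurable)
      (fun t => Filter.Eventually.of_forall fun τ => ?_) (hg.norm.const_mul 2)
      (Filter.Eventually.of_forall fun τ => by fun_prop)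
    rw [norm_norm]
    refine (norm_sub_le _ _).trans (le_of_eq ?_)
    rw [norm_mul, norm_mul, mul_comm I, mul_comm I, Complex.norm_exp_ofReal_mul_I,
      Complex.norm_exp_ofReal_mul_I, mul_one, two_mul]
  have h0 := hc.tendsto t₀
  simp only [sub_self, norm_zero, integral_zero] at h0
  exact squeeze_zero (fun _ => norm_nonneg _)
    (fun t => S.norm_weylIntegral_sub_le (hint t) (hint t₀) Z) h0

end Normal

/-! ### The Gaussian measurement -/

section Measurement

variable {P : OscillatorParams} {H : Type*} [NormedAddCommGroup H]
  [InnerProductSpace ℂ H] [CompleteSpace H] (S : WeylSystem P H)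

/-- The weight of the Weyl operators of `y` in the Gaussian measurement with result `0`. -/
noncomputable def measurementWeight (P : OscillatorParams) (μ : ℝ) (τ : ℂ) : ℂ :=
  (P.hbar / Real.pi : ℂ) * cexp (-((P.hbar * (μ - P.ε / 2) : ℝ) : ℂ) * (‖τ‖ : ℂ) ^ 2)

theorem integrable_measurementWeight (hh : 0 < P.hbar) {μ : ℝ} (hμ : 0 < μ) (hε : P.ε ≤ μ) :
    Integrable (measurementWeight P μ) := by
  have hb : 0 < P.hbar * (μ - P.ε / 2) := mul_pos hh (by linarith)
  have h := (integrable_plane_gaussian hb 0).const_mul (P.hbar / Real.pi : ℂ)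
  simp only [map_zero, zero_mul, Complex.zero_re, mul_zero, ofReal_zero, add_zero] at h
  exact h

theorem planeFourier_mul_cexp_ampCommutator (hh : 0 < P.hbar) {μ : ℝ} (hμ : 0 < μ) (k : ℕ)
    (η τ : ℂ) :
    planeFourier (fun ξ => (complexGaussian P.hbar 0 μ (η - ξ) : ℂ)) τ *
      cexp (ampCommutator P (conj τ • outputVec P k) (conj τ • outputVec P k) / 2) =
    measurementWeight P μ τ * cexp (I * ((2 * (conj τ * -η).re : ℝ) : ℂ)) := by
  rw [planeFourier_complexGaussian hh hμ, measurementWeight, ampCommutator_smul_left,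
    ampCommutator_smul_right, ampCommutator_outputVec_self, Complex.conj_conj,
    mul_assoc (_ / _), mul_assoc (_ / _), ← Complex.exp_add, ← Complex.exp_add]
  congr 2
  rw [mul_neg, Complex.neg_re]
  push_cast
  rw [← Complex.mul_conj']
  ring

theorem WeylSystem.measurement_eq_weylIntegral (hh : 0 < P.hbar) {μ : ℝ} (hμ : 0 < μ) (k : ℕ)
    (h : History k) (η : ℂ) :
    S.measurement (complexGaussian P.hbar 0 μ) (outputAmp P k h) η =
      S.weylIntegral (fun τ => measurementWeight P μ τ *
        cexp (I * ((2 * (conj τ * -η).re : ℝ) : ℂ))) (outputAmp P k h) := by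
  simp only [measurement, symbolOp, outputAmp_snd, planeFourier_mul_cexp_ampCommutator hh hμ]

theorem WeylSystem.measurement_eq_displacement (hh : 0 < P.hbar) {μ : ℝ} (hμ : 0 < μ)
    (hε : P.ε ≤ μ) (k : ℕ) (h : History k) (η : ℂ) :
    S.measurement (complexGaussian P.hbar 0 μ) (outputAmp P k h) η =
      S.weylIntegral (fun τ => measurementWeight P μ τ *
        cexp (I * ((2 * (conj τ * ((outputAmp P k h).1 - η)).re : ℝ) : ℂ)))
          (0, outputVec P k) := by
  have hg := integrable_measurementWeight hh hμ hε
  rw [S.measurement_eq_weylIntegral hh hμ]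
  ext ψ
  rw [S.weylIntegral_apply (integrable_mul_cexp hg _),
    S.weylIntegral_apply (integrable_mul_cexp hg _)]
  refine integral_congr_ae (Filter.Eventually.of_forall fun τ => ?_)
  simp only [weylOp, smul_apply, smul_smul, Prod.smul_fst, Prod.smul_snd,
    outputAmp_snd, smul_eq_mul, mul_zero, Complex.zero_re, ofReal_zero, Complex.exp_zero, mul_one,
    mul_assoc]
  rw [← Complex.exp_add]
  congr 3
  rw [mul_sub, mul_neg, Complex.sub_re, Complex.neg_re]
  push_cast
  ring

end Measurement

/-! ### The total state -/

section TotalState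

theorem measurable_history_prev (k : ℕ) : Measurable (History.prev : History (k + 1) → History k) :=
  (measurable_fst.comp measurable_fst : Measurable fun h : (History k × ℂ) × ℂ => h.1.1)

theorem measurable_history_outcome (k : ℕ) : Measurable (History.outcome : History (k + 1) → ℂ) :=
  (measurable_snd.comp measurable_fst : Measurable fun h : (History k × ℂ) × ℂ => h.1.2)

theorem measurable_history_control (k : ℕ) : Measurable (History.control : History k → ℂ) := by
  cases k with
  | zero => exact (measurable_id : Measurable fun h : ℂ => h)
  | succ k => exact (measurable_snd : Measurable fun h : (History k × ℂ) × ℂ => h.2)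

theorem measurable_objectAmp_fst (P : OscillatorParams) (k : ℕ) :
    Measurable fun h : History k => (objectAmp P k h).1 := by
  induction k with
  | zero => exact measurable_const
  | succ k ih =>
    have h1 := ih.comp (measurable_history_prev k)
    have h2 := (measurable_history_control k).comp (measurable_history_prev k)
    have h3 := ((h1.const_mul P.φ).add (h2.const_mul P.β)).add_const (0 : ℂ)
    exact h3

theorem measurable_outputAmp_fst (P : OscillatorParams) (k : ℕ) :
    Measurable fun h : History k => (outputAmp P k h).1 :=
  (((measurable_objectAmp_fst P k).const_mul P.γ).add
    ((measurable_history_control k).const_mul P.δ)).add_const (0 : ℂ)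

theorem measurable_filterMean (P : OscillatorParams) (G : GaussianParams) (k : ℕ) :
    Measurable (filterMean P G k) := by
  induction k with
  | zero => exact measurable_const
  | succ k ih =>
    have h1 := ih.comp (measurable_history_prev k)
    have h2 := (measurable_history_control k).comp (measurable_history_prev k)
    exact ((h1.const_mul P.φ).add (h2.const_mul P.β)).add
      ((((measurable_history_outcome k).sub (h1.const_mul P.γ)).sub
        (h2.const_mul P.δ)).const_mul _)

/-- The density of the law of the data for the Gaussian filter: the product of the Gaussian
densities of the innovations. -/
noncomputable def dataDensity (P : OscillatorParams) (G : GaussianParams) :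
    ∀ k : ℕ, History k → ℝ
  | 0, _ => 1
  | k + 1, h => dataDensity P G k h.prev *
      complexGaussian P.hbar 0 (innovationVar P G (filterVar P G k))
        (h.outcome - P.γ * filterMean P G k h.prev - P.δ * h.prev.control)

theorem measurable_gaussian (hbar s : ℝ) : Measurable (complexGaussian hbar 0 s) :=
  ((continuous_complexGaussian hbar s).comp
    (by fun_prop : Continuous fun ξ : ℂ => ((0 : ℂ), ξ))).measurable

theorem measurable_innovationDensity (P : OscillatorParams) (G : GaussianParams) (k : ℕ) :
    Measurable fun p : History k × ℂ =>
      complexGaussian P.hbar 0 (innovationVar P G (filterVar P G k))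
        (p.2 - P.γ * filterMean P G k p.1 - P.δ * p.1.control) := by
  have h1 := measurable_filterMean P G k
  have h2 := measurable_history_control k
  refine (measurable_gaussian _ _).comp ?_
  have h3 : Measurable fun p : History k × ℂ => filterMean P G k p.1 := h1.comp measurable_fst
  have h4 : Measurable fun p : History k × ℂ => p.1.control := h2.comp measurable_fst
  exact (measurable_snd.sub (h3.const_mul P.γ)).sub (h4.const_mul P.δ)

theorem measurable_dataDensity (P : OscillatorParams) (G : GaussianParams) (k : ℕ) :
    Measurable (dataDensity P G k) := by
  induction k with
  | zero => exact measurable_const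
  | succ k ih =>
    have h1 : Measurable fun h : History (k + 1) => dataDensity P G k h.prev :=
      ih.comp (measurable_history_prev k)
    have hfst : Measurable fun h : History (k + 1) => (h.prev, h.outcome) :=
      (measurable_history_prev k).prodMk (measurable_history_outcome k)
    have h2 : Measurable fun h : History (k + 1) =>
        complexGaussian P.hbar 0 (innovationVar P G (filterVar P G k))
          (h.outcome - P.γ * filterMean P G k h.prev - P.δ * h.prev.control) :=
      (measurable_innovationDensity P G k).comp hfst
    exact h1.mul h2

theorem sFinite_planeMeasure (hbar : ℝ) : SFinite (planeMeasure hbar) := by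
  unfold planeMeasure
  infer_instance

theorem sFinite_referenceMeasure (hbar : ℝ) (u₀ : ℂ) (c : ∀ k, Kernel (History k × ℂ) ℂ) (k : ℕ) :
    SFinite (referenceMeasure hbar u₀ c k) := by
  cases k with
  | zero => exact (inferInstance : SFinite (Measure.dirac (α := ℂ) u₀))
  | succ k => exact (inferInstance : SFinite
      (((referenceMeasure hbar u₀ c k).prod (planeMeasure hbar)) ⊗ₘ c k))

variable {P : OscillatorParams} {G : GaussianParams}

theorem dataDensity_pos (hS₀ : 0 < G.S₀) (hσ : 0 < G.σ)
    (hυ : ‖G.υ‖ ^ 2 < G.σ * G.ν) (hμ : 0 < G.μ) (k : ℕ) (h : History k) :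
    0 < dataDensity P G k h := by
  induction k with
  | zero => exact one_pos
  | succ k ih => exact mul_pos (ih _) (complexGaussian_pos
      (innovationVar_pos P hσ hυ hμ (filterVar_pos P hS₀ hσ hυ hμ k)) _ _)

theorem lintegral_dataDensity (hhbar : 0 < P.hbar) (hS₀ : 0 < G.S₀) (hσ : 0 < G.σ)
    (hυ : ‖G.υ‖ ^ 2 < G.σ * G.ν) (hμ : 0 < G.μ) (u₀ : ℂ) (c : ∀ k, Kernel (History k × ℂ) ℂ)
    [∀ k, IsMarkovKernel (c k)] (k : ℕ) :
    ∫⁻ h, ENNReal.ofReal (dataDensity P G k h) ∂referenceMeasure P.hbar u₀ c k = 1 := by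
  induction k with
  | zero =>
    have h : ∫⁻ _ : ℂ, ENNReal.ofReal 1 ∂Measure.dirac u₀ = 1 := by simp
    exact h
  | succ k ih =>
    have := sFinite_planeMeasure P.hbar
    have := sFinite_referenceMeasure P.hbar u₀ c k
    have hΨ := innovationVar_pos P hσ hυ hμ (filterVar_pos P hS₀ hσ hυ hμ k)
    let F : History k × ℂ → ENNReal := fun p => ENNReal.ofReal (dataDensity P G k p.1) *
      ENNReal.ofReal (complexGaussian P.hbar 0 (innovationVar P G (filterVar P G k))
        (p.2 - P.γ * filterMean P G k p.1 - P.δ * p.1.control))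
    have hF : Measurable F :=
      ((measurable_dataDensity P G k).comp measurable_fst).ennreal_ofReal.mul
        (measurable_innovationDensity P G k).ennreal_ofReal
    have h1 : ∫⁻ h, ENNReal.ofReal (dataDensity P G (k + 1) h)
        ∂referenceMeasure P.hbar u₀ c (k + 1) =
        ∫⁻ h : (History k × ℂ) × ℂ, F h.1
          ∂(((referenceMeasure P.hbar u₀ c k).prod (planeMeasure P.hbar)) ⊗ₘ c k) :=
      lintegral_congr (μ := ((referenceMeasure P.hbar u₀ c k).prod (planeMeasure P.hbar)) ⊗ₘ c k)
        fun h : (History k × ℂ) × ℂ => ENNReal.ofReal_mul (dataDensity_pos hS₀ hσ hυ hμ k h.1.1).le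
    rw [h1, Measure.lintegral_compProd (f := fun h : (History k × ℂ) × ℂ => F h.1)
      (hF.comp measurable_fst)]
    simp only [lintegral_const, measure_univ, mul_one]
    rw [lintegral_prod _ hF.aemeasurable]
    refine Eq.trans (lintegral_congr fun h => ?_) ih
    simp only [F]
    rw [lintegral_const_mul' _ _ ENNReal.ofReal_ne_top]
    have hshift : ∀ a, complexGaussian P.hbar 0 (innovationVar P G (filterVar P G k))
        (a - (P.γ * filterMean P G k h + P.δ * h.control)) =
        complexGaussian P.hbar (P.γ * filterMean P G k h + P.δ * h.control)
          (innovationVar P G (filterVar P G k)) a := fun a => by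
      simp only [complexGaussian, sub_zero]
    simp only [sub_sub, hshift]
    rw [lintegral_complexGaussian hhbar hΨ, mul_one]

variable {H : Type*} [NormedAddCommGroup H] [InnerProductSpace ℂ H] [CompleteSpace H]
  (S : WeylSystem P H) {π₀ : (H →L[ℂ] H) →ₗ[ℂ] ℂ} {ρ : ℕ → (H →L[ℂ] H) →ₗ[ℂ] ℂ}
  {M : ℕ → (H →L[ℂ] H) →ₗ[ℂ] (H →L[ℂ] H)}

theorem WeylSystem.isNormalFunctional_totalDensity (hπ₀ : IsNormalFunctional π₀)
    (hM : ∀ k f, IsNormalFunctional f → IsNormalFunctional (f ∘ₗ M k)) (m : ℕ → ℂ → ℝ)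
    (k : ℕ) (h : History k) : IsNormalFunctional (S.totalDensity π₀ M m k h) := by
  induction k with
  | zero => exact hπ₀
  | succ k ih => exact (hM k _ (ih _)).comp_mulLeft _

/-- The total state is a strongly measurable function of the data, in the norm of functionals. -/
theorem WeylSystem.exists_stronglyMeasurable_totalDensity (hh : 0 < P.hbar)
    (hπ₀ : IsNormalFunctional π₀)
    (hM : ∀ k f, IsNormalFunctional f → IsNormalFunctional (f ∘ₗ M k))
    {μ : ℝ} (hμ : 0 < μ) (hε : P.ε ≤ μ) (k : ℕ) :
    ∃ F : History k → (H →L[ℂ] H) →L[ℂ] ℂ, StronglyMeasurable F ∧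
      ∀ h a, F h a = S.totalDensity π₀ M (fun _ => complexGaussian P.hbar 0 μ) k h a := by
  induction k with
  | zero =>
    obtain ⟨C, hC⟩ := hπ₀.exists_bound
    exact ⟨fun _ => π₀.mkContinuous C hC, stronglyMeasurable_const, fun h a => rfl⟩
  | succ k ih =>
    obtain ⟨F, hF, hFT⟩ := ih
    let N : (H →L[ℂ] H) →L[ℂ] (H →L[ℂ] H) := ⟨M k, continuous_of_normal (hM k)⟩
    let B : History (k + 1) → H →L[ℂ] H := fun h =>
      S.measurement (complexGaussian P.hbar 0 μ) (outputAmp P k h.prev) h.outcome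
    have hB : StronglyMeasurable B := by
      simp only [B, S.measurement_eq_displacement hh hμ hε]
      have hm : Measurable fun h : History (k + 1) => (outputAmp P k h.prev).1 - h.outcome :=
        ((measurable_outputAmp_fst P k).comp (measurable_history_prev k)).sub
          (measurable_history_outcome k)
      exact (S.continuous_weylIntegral_displacement
        (integrable_measurementWeight hh hμ hε) (0, outputVec P k)).stronglyMeasurable.comp_measurable
          hm
    refine ⟨fun h => (F h.prev).comp (N.comp (ContinuousLinearMap.mul ℂ (H →L[ℂ] H) (B h))),
      ?_, fun h a => ?_⟩
    · have hc : Continuous fun q : ((H →L[ℂ] H) →L[ℂ] ℂ) × (H →L[ℂ] H) =>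
          q.1.comp (N.comp (ContinuousLinearMap.mul ℂ (H →L[ℂ] H) q.2)) := by fun_prop
      exact hc.comp_stronglyMeasurable
        ((hF.comp_measurable (measurable_history_prev k)).prodMk hB)
    · exact hFT _ _

/-- The ordered characteristic function of the total state. -/
theorem WeylSystem.totalDensity_ordExp (hh : 0 < P.hbar) (hS₀ : 0 < G.S₀) (hσ : 0 < G.σ)
    (hυ : ‖G.υ‖ ^ 2 < G.σ * G.ν) (hμ : 0 < G.μ) (hε : P.ε ≤ G.μ)
    (hπ₀ : IsNormalFunctional π₀)
    (hπ₀G : S.HasDistribution π₀ Mode.x.amp (complexGaussian P.hbar G.z G.S₀))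
    (hρG : ∀ k, S.HasDistribution₂ (ρ k) (Mode.v k).amp (Mode.w k).amp (noiseGaussian P.hbar G))
    (hM : S.IsDynamics ρ M) (k : ℕ) (h : History k) (τ : ℂ) :
    S.totalDensity π₀ M (fun _ => complexGaussian P.hbar 0 G.μ) k h
        (S.ordExp (conj τ • objectAmp P k h)) =
      dataDensity P G k h * cexp (I * ((2 * (conj τ * filterMean P G k h).re : ℝ) : ℂ) -
        P.hbar * filterVar P G k * (‖τ‖ : ℂ) ^ 2) := by
  induction k generalizing τ with
  | zero =>
    have h1 := hπ₀G τ
    rw [charFun_complexGaussian hh hS₀] at h1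
    simpa [dataDensity, objectAmp, filterMean, filterVar, totalDensity] using h1
  | succ k ih =>
    have hg := integrable_measurementWeight hh hμ hε
    set T := S.totalDensity π₀ M (fun _ => complexGaussian P.hbar 0 G.μ) k h.prev with hT
    have hTn : IsNormalFunctional T :=
      S.isNormalFunctional_totalDensity hπ₀ (fun k => (hM k).normal) _ k h.prev
    have hfn := ((hM k).normal T hTn).comp_mulRight (S.ordExp (conj τ • objectAmp P (k + 1) h))
    have h1 : S.totalDensity π₀ M (fun _ => complexGaussian P.hbar 0 G.μ) (k + 1) h
        (S.ordExp (conj τ • objectAmp P (k + 1) h)) =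
        ((T ∘ₗ M k) ∘ₗ LinearMap.mulRight ℂ (S.ordExp (conj τ • objectAmp P (k + 1) h)))
          (S.measurement (complexGaussian P.hbar 0 G.μ) (outputAmp P k h.prev) h.outcome) := rfl
    rw [h1, S.measurement_eq_weylIntegral hh hμ,
      hfn.map_weylIntegral S (integrable_mul_cexp hg _)]
    have h2 : ∀ s : ℂ, measurementWeight P G.μ s *
        cexp (I * ((2 * (conj s * -h.outcome).re : ℝ) : ℂ)) *
        ((T ∘ₗ M k) ∘ₗ LinearMap.mulRight ℂ (S.ordExp (conj τ • objectAmp P (k + 1) h)))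
          (S.weylOp (conj s • outputAmp P k h.prev)) =
        dataDensity P G k h.prev * (((P.hbar / Real.pi : ℂ) *
          cexp (-(I * ((2 * (conj s * h.outcome).re : ℝ) : ℂ)) -
            P.hbar * G.μ * (‖s‖ : ℂ) ^ 2)) *
          (cexp (I * ((2 * (conj s * (P.δ * h.prev.control) +
            conj τ * (P.β * h.prev.control)).re : ℝ) : ℂ)) *
          (cexp (I * ((2 * ((conj s * P.γ + conj τ * P.φ) *
              filterMean P G k h.prev).re : ℝ) : ℂ) -
            P.hbar * filterVar P G k * (‖conj s * P.γ + conj τ * P.φ‖ : ℂ) ^ 2) *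
          cexp (-(P.hbar * (G.σ * (‖τ‖ : ℂ) ^ 2 - ((2 * (G.υ * conj τ * s).re : ℝ) : ℂ) +
            G.ν * (‖s‖ : ℂ) ^ 2)))))) := by
      intro s
      have hord : cexp (ampCommutator P (conj s • outputVec P k) (conj s • outputVec P k) / 2) *
          ((T ∘ₗ M k) ∘ₗ LinearMap.mulRight ℂ (S.ordExp (conj τ • objectAmp P (k + 1) h)))
            (S.weylOp (conj s • outputAmp P k h.prev)) =
          T (M k (S.ordExp (conj s • outputAmp P k h.prev) *
            S.ordExp (conj τ • objectAmp P (k + 1) h))) := by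
        rw [← smul_eq_mul, ← map_smul, ← outputAmp_snd P k h.prev]
        rfl
      have hA : S.ordExp ((conj s * P.γ + conj τ * P.φ) • objectAmp P k h.prev) ∈
          S.algebra {Z | ∃ h : History k, Z = objectAmp P k h} :=
        S.ordExp_mem_algebra (A := {Z | ∃ h : History k, Z = objectAmp P k h}) ⟨h.prev, rfl⟩ _
      have hB : S.ordExp (conj τ • (Mode.v k).amp + conj s • (Mode.w k).amp) ∈
          S.algebra {(Mode.v k).amp, (Mode.w k).amp} :=
        S.ordExp_add_mem_algebra (A := {(Mode.v k).amp, (Mode.w k).amp}) (Set.mem_insert _ _)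
          (Set.mem_insert_of_mem _ rfl) _ _
      have hx := ih h.prev (conj (conj s * P.γ + conj τ * P.φ))
      rw [Complex.conj_conj, RCLike.norm_conj] at hx
      rw [← planeFourier_mul_cexp_ampCommutator hh hμ k, mul_assoc, hord,
        planeFourier_complexGaussian hh hμ, S.ordExp_output_mul_object, map_smul,
        (hM k).slice _ hA _ hB, hρG k τ s, charFun_noiseGaussian hh hσ hυ, map_smul, map_smul,
        hT, hx]
      simp only [smul_eq_mul]
      ring
    simp only [h2]
    rw [integral_const_mul, kalman_integral hh P G
      (innovationVar_pos P hσ hυ hμ (filterVar_pos P hS₀ hσ hυ hμ k))]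
    simp only [dataDensity, filterMean, filterVar]
    push_cast
    ring

end TotalState

/-! ### A posteriori states -/

theorem ae_eq_of_forall_setIntegral_eq_of_integrable_right {X E : Type*} [MeasurableSpace X]
    [NormedAddCommGroup E] [NormedSpace ℝ E] [CompleteSpace E] {μ : Measure X} [IsFiniteMeasure μ]
    {f g : X → E} (hf : AEStronglyMeasurable f μ) (hg : Integrable g μ)
    (h : ∀ s, MeasurableSet s → ∫ x in s, f x ∂μ = ∫ x in s, g x ∂μ) : f =ᵐ[μ] g := by
  let s : ℕ → Set X := fun n => {x | ‖hf.mk f x‖ ≤ n}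
  have hs : ∀ n, MeasurableSet (s n) := fun n =>
    measurableSet_le hf.stronglyMeasurable_mk.norm.measurable measurable_const
  have hfi : ∀ n, Integrable f (μ.restrict (s n)) := by
    intro n
    refine Integrable.congr ?_ (ae_restrict_of_ae hf.ae_eq_mk.symm)
    refine (integrable_const (n : ℝ)).mono' hf.stronglyMeasurable_mk.aestronglyMeasurable ?_
    exact ae_restrict_of_forall_mem (hs n) fun x hx => hx
  have heq : ∀ n, f =ᵐ[μ.restrict (s n)] g := by
    intro n
    refine Integrable.ae_eq_of_forall_setIntegral_eq f g (hfi n) hg.restrict fun t ht _ => ?_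
    rw [Measure.restrict_restrict ht]
    exact h _ (ht.inter (hs n))
  have hall : ∀ᵐ x ∂μ, ∀ n, x ∈ s n → f x = g x :=
    ae_all_iff.mpr fun n => (ae_restrict_iff' (hs n)).mp (heq n)
  filter_upwards [hall] with x hx
  obtain ⟨n, hn⟩ := exists_nat_ge ‖hf.mk f x‖
  exact hx n hn

section Posterior

variable {P : OscillatorParams} {G : GaussianParams}
  {H : Type*} [NormedAddCommGroup H] [InnerProductSpace ℂ H] [CompleteSpace H]
  (S : WeylSystem P H)

theorem IsNormalFunctional.continuous_W {f : (H →L[ℂ] H) →ₗ[ℂ] ℂ} (hf : IsNormalFunctional f)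
    (Z : Mode →₀ ℂ) : Continuous fun τ : ℂ => f (S.W (conj τ • Z)) :=
  hf.continuous_comp (fun χ => (S.regular Z χ).comp Complex.continuous_conj)
    fun _ χ => (S.norm_W _ χ).le

theorem WeylSystem.W_mem_objectAlgebra (k : ℕ) (τ : ℂ) :
    S.W (τ • objectVec P k) ∈ S.objectAlgebra k := by
  have h0 : Nonempty (History k) := by
    induction k with
    | zero => exact ⟨(0 : ℂ)⟩
    | succ k ih => exact ih.map fun h => ((h, (0 : ℂ)), (0 : ℂ))
  obtain ⟨h⟩ := h0
  have h1 := S.weylOp_mem_algebra (A := {Z | ∃ h : History k, Z = objectAmp P k h}) ⟨h, rfl⟩ τ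
  have h2 := S.smul_mem_algebra h1 (cexp (I * ((2 * (τ • objectAmp P k h).1.re : ℝ) : ℂ)))⁻¹
  rwa [weylOp, smul_smul, inv_mul_cancel₀ (Complex.exp_ne_zero _), one_smul, Prod.smul_snd,
    objectAmp_snd] at h2

theorem WeylSystem.ordExp_objectAmp (k : ℕ) (h : History k) (τ : ℂ) :
    S.ordExp (conj τ • objectAmp P k h) = (cexp ((P.hbar * ‖τ‖ ^ 2 / 2 : ℝ)) *
      cexp (I * ((2 * (conj τ * (objectAmp P k h).1).re : ℝ) : ℂ))) •
        S.W (conj τ • objectVec P k) := by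
  rw [S.ordExp_smul_eq, objectAmp_snd, ampCommutator_smul_left, ampCommutator_smul_right,
    ampCommutator_objectVec_self, Complex.conj_conj]
  congr 3
  push_cast
  rw [← Complex.mul_conj']
  ring

variable {π₀ : (H →L[ℂ] H) →ₗ[ℂ] ℂ} {ρ : ℕ → (H →L[ℂ] H) →ₗ[ℂ] ℂ}
  {M : ℕ → (H →L[ℂ] H) →ₗ[ℂ] (H →L[ℂ] H)}

theorem WeylSystem.norm_totalDensity_W_le (hh : 0 < P.hbar) (hS₀ : 0 < G.S₀) (hσ : 0 < G.σ)
    (hυ : ‖G.υ‖ ^ 2 < G.σ * G.ν) (hμ : 0 < G.μ) (hε : P.ε ≤ G.μ)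
    (hπ₀ : IsNormalFunctional π₀)
    (hπ₀G : S.HasDistribution π₀ Mode.x.amp (complexGaussian P.hbar G.z G.S₀))
    (hρG : ∀ k, S.HasDistribution₂ (ρ k) (Mode.v k).amp (Mode.w k).amp (noiseGaussian P.hbar G))
    (hM : S.IsDynamics ρ M) (k : ℕ) (h : History k) (τ : ℂ) :
    ‖S.totalDensity π₀ M (fun _ => complexGaussian P.hbar 0 G.μ) k h
      (S.W (conj τ • objectVec P k))‖ ≤ dataDensity P G k h := by
  have h1 := congrArg norm
    (S.totalDensity_ordExp hh hS₀ hσ hυ hμ hε hπ₀ hπ₀G hρG hM k h τ)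
  have hv := filterVar_pos P hS₀ hσ hυ hμ k
  have hd := dataDensity_pos (P := P) hS₀ hσ hυ hμ k h
  have e : I * ((2 * (conj τ * filterMean P G k h).re : ℝ) : ℂ) -
        P.hbar * filterVar P G k * (‖τ‖ : ℂ) ^ 2 =
      ((2 * (conj τ * filterMean P G k h).re : ℝ) : ℂ) * I +
        ((-(P.hbar * filterVar P G k * ‖τ‖ ^ 2) : ℝ) : ℂ) := by
    push_cast
    ring
  rw [S.ordExp_objectAmp, map_smul, norm_smul, norm_mul, norm_mul, mul_comm I,
    Complex.norm_exp_ofReal_mul_I, mul_one, e, Complex.exp_add, norm_mul,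
    Complex.norm_exp_ofReal_mul_I, one_mul, Complex.norm_exp_ofReal, Complex.norm_exp_ofReal,
    Complex.norm_real, Real.norm_of_nonneg hd.le] at h1
  have h2 : Real.exp (-(P.hbar * filterVar P G k * ‖τ‖ ^ 2)) ≤ 1 :=
    Real.exp_le_one_iff.mpr (by simp only [Left.neg_nonpos_iff]; positivity)
  have h3 : 1 ≤ Real.exp (P.hbar * ‖τ‖ ^ 2 / 2) := Real.one_le_exp (by positivity)
  calc _ ≤ Real.exp (P.hbar * ‖τ‖ ^ 2 / 2) * _ := le_mul_of_one_le_left (norm_nonneg _) h3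
    _ = _ := h1
    _ ≤ _ := mul_le_of_le_one_right hd.le h2

end Posterior

theorem theorem3 {H : Type*} [NormedAddCommGroup H] [InnerProductSpace ℂ H] [CompleteSpace H]
    (P : OscillatorParams) (G : GaussianParams)
    (hhbar : 0 < P.hbar) (hS₀ : 0 < G.S₀) (hσ : 0 < G.σ) (hυ : ‖G.υ‖ ^ 2 < G.σ * G.ν)
    (hμ : 0 < G.μ) (hεμ : P.ε ≤ G.μ)
    (S : WeylSystem P H)
    (π₀ : (H →L[ℂ] H) →ₗ[ℂ] ℂ) (hπ₀ : IsNormalState π₀)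
    (hπ₀G : S.HasDistribution π₀ Mode.x.amp (complexGaussian P.hbar G.z G.S₀))
    (ρ : ℕ → (H →L[ℂ] H) →ₗ[ℂ] ℂ) (hρ : ∀ k, IsNormalState (ρ k))
    (hρG : ∀ k, S.HasDistribution₂ (ρ k) (Mode.v k).amp (Mode.w k).amp (noiseGaussian P.hbar G))
    (M : ℕ → (H →L[ℂ] H) →ₗ[ℂ] (H →L[ℂ] H)) (hM : S.IsDynamics ρ M)
    (m : ℕ → ℂ → ℝ) (hm : ∀ k, m k = complexGaussian P.hbar 0 G.μ)
    (u₀ : ℂ) (c : ∀ k, Kernel (History k × ℂ) ℂ) [∀ k, IsMarkovKernel (c k)]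
    (k : ℕ) :
    0 < filterVar P G k ∧ 0 < innovationVar P G (filterVar P G k) ∧
    IsProbabilityMeasure (S.dataLaw π₀ M m u₀ c k) ∧
    (∃ ϖ : History k → (H →L[ℂ] H) →ₗ[ℂ] ℂ, S.IsAPosteriori π₀ M m u₀ c k ϖ) ∧
    ∀ ϖ : History k → (H →L[ℂ] H) →ₗ[ℂ] ℂ, S.IsAPosteriori π₀ M m u₀ c k ϖ →
      ∀ᵐ h ∂(S.dataLaw π₀ M m u₀ c k),
        S.HasDistribution (ϖ h) (objectAmp P k h)
          (complexGaussian P.hbar (filterMean P G k h) (filterVar P G k)) := by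
  obtain rfl : m = fun _ => complexGaussian P.hbar 0 G.μ := funext hm
  have hπn := hπ₀.normal
  have hMn : ∀ k f, IsNormalFunctional f → IsNormalFunctional (f ∘ₗ M k) := fun k => (hM k).normal
  have hfv := filterVar_pos P hS₀ hσ hυ hμ k
  set T := S.totalDensity π₀ M (fun _ => complexGaussian P.hbar 0 G.μ) k with hT
  set ν := referenceMeasure P.hbar u₀ c k with hν
  have hdpos : ∀ h, 0 < dataDensity P G k h := dataDensity_pos hS₀ hσ hυ hμ k
  have hord := S.totalDensity_ordExp hhbar hS₀ hσ hυ hμ hεμ hπn hπ₀G hρG hM k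
  have hone : ∀ h, T h 1 = dataDensity P G k h := by
    intro h
    have h1 := hord h 0
    have h2 : S.ordExp (0 : Amplitude) = 1 := by
      simp [WeylSystem.ordExp, WeylSystem.weylOp, ampCommutator, S.map_zero]
    simpa [h2] using h1
  set L := S.dataLaw π₀ M (fun _ => complexGaussian P.hbar 0 G.μ) u₀ c k with hL
  have hLeq : L = ν.withDensity fun h => ENNReal.ofReal (dataDensity P G k h) := by
    rw [hL, WeylSystem.dataLaw]
    refine congrArg _ (funext fun h => ?_)
    have h1 : S.totalDensity π₀ M (fun _ => complexGaussian P.hbar 0 G.μ) k h 1 =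
      dataDensity P G k h := hone h
    rw [h1, Complex.ofReal_re]
  have hprob : IsProbabilityMeasure L := by
    refine ⟨?_⟩
    rw [hLeq, withDensity_apply _ MeasurableSet.univ, Measure.restrict_univ]
    exact lintegral_dataDensity hhbar hS₀ hσ hυ hμ u₀ c k
  have hTn : ∀ h, IsNormalFunctional (T h) :=
    S.isNormalFunctional_totalDensity hπn hMn _ k
  have hTm : ∀ a, StronglyMeasurable fun h => T h a := by
    intro a
    obtain ⟨F, hF, hFT⟩ := S.exists_stronglyMeasurable_totalDensity hhbar hπn hMn hμ hεμ k
    have h1 : StronglyMeasurable fun h => F h a :=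
      (ContinuousLinearMap.apply ℂ ℂ a).continuous.comp_stronglyMeasurable hF
    simpa only [hFT] using h1
  have hdm := measurable_dataDensity P G k
  let ϖ₀ : History k → (H →L[ℂ] H) →ₗ[ℂ] ℂ := fun h => ((dataDensity P G k h : ℂ)⁻¹) • T h
  have hϖ₀m : ∀ a, StronglyMeasurable fun h => ϖ₀ h a := by
    intro a
    have h1 : StronglyMeasurable fun h => (dataDensity P G k h : ℂ)⁻¹ :=
      (Complex.measurable_ofReal.comp hdm).inv.stronglyMeasurable
    exact h1.mul (hTm a)
  have hϖ₀int : ∀ a, ∀ E : Set (History k), MeasurableSet E →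
      ∫ h in E, ϖ₀ h a ∂L = ∫ h in E, T h a ∂ν := by
    intro a E hE
    rw [hLeq, setIntegral_withDensity_eq_setIntegral_toReal_smul hdm.ennreal_ofReal
      (Filter.Eventually.of_forall fun h => ENNReal.ofReal_lt_top) _ hE]
    refine integral_congr_ae (Filter.Eventually.of_forall fun h => ?_)
    have h1 : (dataDensity P G k h : ℂ) ≠ 0 := by exact_mod_cast (hdpos h).ne'
    simp only [ϖ₀, LinearMap.smul_apply, smul_eq_mul, ENNReal.toReal_ofReal (hdpos h).le,
      Complex.real_smul]
    rw [mul_inv_cancel_left₀ h1]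
  have hϖ₀n : ∀ h, IsNormalFunctional (ϖ₀ h) := fun h => (hTn h).smul _
  refine ⟨hfv, innovationVar_pos P hσ hυ hμ hfv, hprob,
    ⟨ϖ₀, hϖ₀n, fun a _ => ⟨(hϖ₀m a).aestronglyMeasurable, hϖ₀int a⟩⟩, fun ϖ hϖ => ?_⟩
  have hW : ∀ τ : ℂ, ∀ᵐ h ∂L,
      ϖ h (S.W (conj τ • objectVec P k)) = ϖ₀ h (S.W (conj τ • objectVec P k)) := by
    intro τ
    obtain ⟨hm1, hm2⟩ := hϖ.2 _ (S.W_mem_objectAlgebra k (conj τ))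
    refine ae_eq_of_forall_setIntegral_eq_of_integrable_right hm1 ?_ fun E hE =>
      (hm2 E hE).trans (hϖ₀int _ E hE).symm
    refine (integrable_const (1 : ℝ)).mono' (hϖ₀m _).aestronglyMeasurable
      (Filter.Eventually.of_forall fun h => ?_)
    have h1 := S.norm_totalDensity_W_le hhbar hS₀ hσ hυ hμ hεμ hπn hπ₀G hρG hM k h τ
    simp only [ϖ₀, LinearMap.smul_apply, smul_eq_mul, norm_mul, norm_inv, Complex.norm_real,
      Real.norm_of_nonneg (hdpos h).le]
    rw [inv_mul_le_iff₀ (hdpos h), mul_one]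
    exact h1
  have hdense := ae_all_iff.mpr fun n : ℕ => hW (TopologicalSpace.denseSeq ℂ n)
  filter_upwards [hdense] with h hh
  have hall : (fun τ : ℂ => ϖ h (S.W (conj τ • objectVec P k))) =
      fun τ : ℂ => ϖ₀ h (S.W (conj τ • objectVec P k)) :=
    Continuous.ext_on (TopologicalSpace.denseRange_denseSeq ℂ) ((hϖ.1 h).continuous_W S _)
      ((hϖ₀n h).continuous_W S _) (by rintro _ ⟨n, rfl⟩; exact hh n)
  intro τ
  have h1 : ϖ h (S.ordExp (conj τ • objectAmp P k h)) =
      ϖ₀ h (S.ordExp (conj τ • objectAmp P k h)) := by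
    rw [S.ordExp_objectAmp, map_smul, map_smul, congrFun hall τ]
  have h2 : (dataDensity P G k h : ℂ) ≠ 0 := by exact_mod_cast (hdpos h).ne'
  rw [h1, charFun_complexGaussian hhbar hfv]
  simp only [ϖ₀, LinearMap.smul_apply, smul_eq_mul]
  rw [hT, hord h τ, inv_mul_cancel_left₀ h2]
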